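/- **Theorem (Universality).** A *ribbon graph* $\mathbb{G}=(V,E)$ is a (possibly disconnected, possibly non-orientable) surface with boundary that is a finite union of discs, the vertices $V$ and the edges $E$, such that vertices and edges meet in disjoint line segments, each such segment lies on the boundary of exactly one vertex and exactly one edge, and each edge contains exactly two of them. A *coloured ribbon graph* is a ribbon graph with a partition $\mathcal V$ of its vertices and a partition $\mathcal B$ of its boundary components into colour classes. Coloured ribbon graphs are considered up to homeomorphisms that preserve vertices, edges and colour classes. Deleting an edge $e$ removes its disc; vertex colours are unchanged, the (one or two) boundary components touching $e$ are replaced by the new ones, and the colour classes of the former are merged into one class that contains the new ones. Contracting $e$, with ends $u,v$ (possibly $u=v$), replaces $e,u,v$ by one new vertex disc attached along each boundary curve of $e\cup u\cup v$; boundary components and their colours are unchanged, and the colour classes of $u$ and $v$ are merged into one class that contains the new vertices. A class of coloured ribbon graphs is *minor-closed* if it is closed under deleting and contracting edges. Ignoring isolated vertices, there are five coloured ribbon graphs with one edge: an edge joining two vertices of different colours ($\mathrm{bs}$) or of the same colour ($\mathrm{bp}$); an orientable loop at one vertex whose two boundary components have different colours ($\mathrm{olc}$) or the same colour ($\mathrm{olh}$);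 and a non-orientable loop at one vertex ($\mathrm{nl}$). With $e^c=E\setminus\{e\}$, an edge $e$ of $\mathbb G$ has *type* $(i,j)$ if, ignoring isolated vertices, $\mathbb G/e^c$ is $i$ and $\mathbb G\backslash e^c$ is $j$. Let $$R=\mathbb{Z}[\alpha,\beta,\gamma,a_{\mathrm{bs}},a_{\mathrm{bp}}^{1/2},a_{\mathrm{olc}},a_{\mathrm{olh}}^{1/2},b_{\mathrm{bs}},b_{\mathrm{bp}}^{1/2},b_{\mathrm{olc}},b_{\mathrm{olh}}^{1/2}],\qquad a_{\mathrm{nl}}=a_{\mathrm{bp}}^{1/2}a_{\mathrm{olh}}^{1/2},\quad b_{\mathrm{nl}}=b_{\mathrm{bp}}^{1/2}b_{\mathrm{olh}}^{1/2}.$$ Let $\mathcal{G}$ be a minor-closed class of coloured ribbon graphs. Then there is a unique map $U:\mathcal{G}\to R$ such that, for all $\mathbb G\in\mathcal G$, $$U(\mathbb{G})=\begin{cases}a_iU(\mathbb{G}\backslash e)+b_jU(\mathbb{G}/e)&\text{for every edge } e \text{ of } \mathbb G,\text{ of type }(i,j),\\ \alpha^n\beta^m\gamma^v&\text{if }\mathbb{G}\text{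 is edgeless with }v\text{ vertices, }n\text{ vertex colour classes and }m\text{ boundary colour classes.}\end{cases}$$ Moreover, let $k(H)$ be the number of components of a graph $H$, and let $r_H(A)$ be the number of vertices minus the number of components of its spanning subgraph with edge set $A$. Let $\mathbb G/\mathcal V$ be the graph on the vertex colour classes in which each edge of $\mathbb G$ joins the classes of its end vertices, and let $\mathbb G^*/\mathcal B$ be the graph on the boundary colour classes in which each edge of $\mathbb G$ joins the classes of the boundary components touching it. For $A\subseteq E$ let $k(A)$ and $b(A)$ be the numbers of components and of boundary components of the spanning ribbon subgraph with edge set $A$, let $v(\mathbb G)=|V|$, $r(A)=|V|-k(A)$, let $\gamma(A)=2k(A)-|V|+|A|-b(A)$ (its Euler genus), and let $\rho(A)=r(A)+\tfrac12\gamma(A)$. Put $A^c=E\setminus A$ and $$r_1(A)=r_{\mathbb G/\mathcal V}(A),\quad r_2(A)=\rho(A)-r_1(A),\quad r_3(A)=r_{\mathbb G^*/\mathcal B}(E)-r_{\mathbb G^*/\mathcal B}(A^c),\quad r_4(A)=|A|-r_3(A)-\rho(A),$$ $\rho(\mathbb G)=\rho(E)$, $r_i(\mathbb G)=r_i(E)$,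 and $$T_{ps}(\mathbb G;w,x,y,z)=\sum_{A\subseteq E}w^{r_1(E)-r_1(A)}x^{r_2(E)-r_2(A)}y^{r_3(A)}z^{r_4(A)}.$$ Then, in any field that contains $R$ and a square root $\gamma^{1/2}$ of $\gamma$, $$U(\mathbb{G})=\alpha^{k(\mathbb{G}/\mathcal{V})}\beta^{k(\mathbb{G}^*/\mathcal{B})}\gamma^{v(\mathbb{G})-\rho(\mathbb{G})}b_{\mathrm{bs}}^{r_1(\mathbb{G})}b_{\mathrm{bp}}^{r_2(\mathbb{G})}a_{\mathrm{olc}}^{r_3(\mathbb{G})}a_{\mathrm{olh}}^{r_4(\mathbb{G})}\;T_{ps}\!\left(\mathbb{G};\frac{\alpha\gamma\,a_{\mathrm{bs}}}{b_{\mathrm{bs}}},\frac{\gamma\,a_{\mathrm{bp}}}{b_{\mathrm{bp}}},\frac{\beta\gamma\,b_{\mathrm{olc}}}{a_{\mathrm{olc}}},\frac{\gamma\,b_{\mathrm{olh}}}{a_{\mathrm{olh}}}\right),$$ where half-integral powers are taken with respect to $\gamma^{1/2}$ and the generators $a_{\mathrm{bp}}^{1/2},a_{\mathrm{olh}}^{1/2},b_{\mathrm{bp}}^{1/2},b_{\mathrm{olh}}^{1/2}$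 of $R$ (so that, for example, the square root of $\gamma a_{\mathrm{bp}}/b_{\mathrm{bp}}$ is $\gamma^{1/2}a_{\mathrm{bp}}^{1/2}/b_{\mathrm{bp}}^{1/2}$). -/

import Mathlib

noncomputable section

namespace RibbonTutte

/-! ## Abstract graphs given by partitions

A graph is presented on a set `F` by a partition `s` (its vertices are the classes of `s`) and a
finite collection `A` of subsets of `F` (its edges; an edge is incident with the classes of `s`
that it meets). -/

/-- The number of classes of an equivalence relation. -/
def numClasses {F : Type} (s : Setoid F) : ℕ := Nat.card (Quotient s)

/-- The equivalence relation generated by `x ∼ f x` and `x ∼ g x`; its classes are the orbits of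
the group generated by the involutions `f` and `g`. -/
def orbitRel {F : Type} (f g : F → F) : Setoid F :=
  Relation.EqvGen.setoid fun x y => y = f x ∨ y = g x

/-- The equivalence relation generated by lying in a common member of `A`. -/
def joinRel {F : Type} (A : Finset (Finset F)) : Setoid F :=
  Relation.EqvGen.setoid fun x y => ∃ e ∈ A, x ∈ e ∧ y ∈ e

/-- The number of connected components of the graph whose vertices are the classes of `s` and
whose edge set is `A`. -/
def graphComponents {F : Type} (s : Setoid F) (A : Finset (Finset F)) : ℕ :=
  numClasses (s ⊔ joinRel A)

/-- The rank (number of vertices minus number of components) of the spanning subgraph with edge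
set `A` of a graph whose vertices are the classes of `s`. -/
def graphRank {F : Type} (s : Setoid F) (A : Finset (Finset F)) : ℤ :=
  (numClasses s : ℤ) - (graphComponents s A : ℤ)

/-! ## Ribbon graphs -/

/-- A ribbon graph, presented by the combinatorics of its vertex and edge discs.

Finitely many marked points, the *flags*, are placed on the boundary circles of the vertex discs,
at least two on each circle, an even number on each.  They cut these circles into arcs that are
alternately *corner arcs*, which belong to the boundary of the surface, and *attaching arcs*.
Every attaching arc is either a segment in which the vertex disc meets an edge disc, or it is
*inert*: no edge disc is there, and it is a part of the boundary of the surface as well.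
Every edge disc is a rectangle with two opposite sides on attaching arcs; the other two
sides are part of the boundary of the surface.

* `τ₁` exchanges the two ends of each corner arc;
* `τ₂` exchanges the two ends of each attaching arc;
* `τ₀` exchanges the two ends of each free side of an edge disc, and it exchanges the two ends of
  each inert arc (so that a flag is an end of an inert arc if and only if `τ₀` and `τ₂` agree on
  it).

Thus the boundary circles of the vertex discs are the orbits of `⟨τ₁, τ₂⟩`, the boundary
components of the surface are the orbits of `⟨τ₀, τ₁⟩`, and the edges are the orbits of
`⟨τ₀, τ₂⟩` on which `τ₀` and `τ₂` differ; such an orbit consists of the four corners of the edge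
disc.  An isolated vertex is a circle all of whose attaching arcs are inert.  Without inert arcs,
this is the usual description of a (possibly non-orientable) map by its flags. -/
structure RibbonGraph where
  Flag : Type
  [fintypeFlag : Fintype Flag]
  [decEqFlag : DecidableEq Flag]
  τ₀ : Flag → Flag
  τ₁ : Flag → Flag
  τ₂ : Flag → Flag
  τ₀_τ₀ : ∀ x, τ₀ (τ₀ x) = x
  τ₁_τ₁ : ∀ x, τ₁ (τ₁ x) = x
  τ₂_τ₂ : ∀ x, τ₂ (τ₂ x) = x
  τ₀_ne : ∀ x, τ₀ x ≠ x
  τ₁_ne : ∀ x, τ₁ x ≠ x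
  τ₂_ne : ∀ x, τ₂ x ≠ x
  τ₀_τ₂ : ∀ x, τ₀ (τ₂ x) = τ₂ (τ₀ x)

attribute [instance] RibbonGraph.fintypeFlag RibbonGraph.decEqFlag

namespace RibbonGraph

variable (G : RibbonGraph)

/-- The flag `x` is a corner of an edge disc (and not an end of an inert arc). -/
def OnEdge (x : G.Flag) : Prop := G.τ₀ x ≠ G.τ₂ x

instance (x : G.Flag) : Decidable (G.OnEdge x) := inferInstanceAs (Decidable (_ ≠ _))

/-- The orbit of a flag under `⟨τ₀, τ₂⟩`. -/
def edgeOf (x : G.Flag) : Finset G.Flag := {x, G.τ₀ x, G.τ₂ x, G.τ₀ (G.τ₂ x)}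

/-- The set of edges; an edge is represented by the set of the four corners of its disc. -/
def edges : Finset (Finset G.Flag) := (Finset.univ.filter G.OnEdge).image G.edgeOf

/-- The vertices are the classes of this relation. -/
def vertexRel : Setoid G.Flag := orbitRel G.τ₁ G.τ₂

/-- The boundary components are the classes of this relation. -/
def boundaryRel : Setoid G.Flag := orbitRel G.τ₀ G.τ₁

/-- The number `v(G)` of vertices. -/
def numVertices : ℕ := numClasses G.vertexRel

/-- The number `b(G)` of boundary components. -/
def numBoundary : ℕ := numClasses G.boundaryRel

theorem edgeOf_τ₀ (x : G.Flag) : G.edgeOf (G.τ₀ x) = G.edgeOf x := by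
  ext y
  simp only [edgeOf, Finset.mem_insert, Finset.mem_singleton, G.τ₀_τ₀, ← G.τ₀_τ₂]
  tauto

theorem edgeOf_τ₂ (x : G.Flag) : G.edgeOf (G.τ₂ x) = G.edgeOf x := by
  ext y
  simp only [edgeOf, Finset.mem_insert, Finset.mem_singleton, G.τ₂_τ₂]
  tauto

theorem self_mem_edgeOf (x : G.Flag) : x ∈ G.edgeOf x := by
  simp [edgeOf]

theorem τ₀_mem_edgeOf (x : G.Flag) : G.τ₀ x ∈ G.edgeOf x := by
  simp [edgeOf]

theorem τ₂_mem_edgeOf (x : G.Flag) : G.τ₂ x ∈ G.edgeOf x := by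
  simp [edgeOf]

/-- Deletion of the edges in `A`: their discs are removed, so their attaching arcs become
inert. -/
def delete (A : Finset (Finset G.Flag)) : RibbonGraph where
  Flag := G.Flag
  τ₀ x := if G.edgeOf x ∈ A then G.τ₂ x else G.τ₀ x
  τ₁ := G.τ₁
  τ₂ := G.τ₂
  τ₀_τ₀ x := by
    by_cases h : G.edgeOf x ∈ A <;> simp [h, edgeOf_τ₀, edgeOf_τ₂, G.τ₀_τ₀, G.τ₂_τ₂]
  τ₁_τ₁ := G.τ₁_τ₁
  τ₂_τ₂ := G.τ₂_τ₂
  τ₀_ne x := by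
    by_cases h : G.edgeOf x ∈ A <;> simp [h, G.τ₀_ne, G.τ₂_ne]
  τ₁_ne := G.τ₁_ne
  τ₂_ne := G.τ₂_ne
  τ₀_τ₂ x := by
    by_cases h : G.edgeOf x ∈ A <;> simp [h, edgeOf_τ₂, G.τ₀_τ₂]

/-- Contraction of the edges in `A`: these edge discs and their incident vertex discs are
replaced by discs whose boundary circles are the boundary curves of their union.  The new circles
pass along the free sides of the edges in `A`, which become inert arcs. -/
def contract (A : Finset (Finset G.Flag)) : RibbonGraph where
  Flag := G.Flag
  τ₀ := G.τ₀
  τ₁ := G.τ₁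
  τ₂ x := if G.edgeOf x ∈ A then G.τ₀ x else G.τ₂ x
  τ₀_τ₀ := G.τ₀_τ₀
  τ₁_τ₁ := G.τ₁_τ₁
  τ₂_τ₂ x := by
    by_cases h : G.edgeOf x ∈ A <;> simp [h, edgeOf_τ₀, edgeOf_τ₂, G.τ₀_τ₀, G.τ₂_τ₂]
  τ₀_ne := G.τ₀_ne
  τ₁_ne := G.τ₁_ne
  τ₂_ne x := by
    by_cases h : G.edgeOf x ∈ A <;> simp [h, G.τ₀_ne, G.τ₂_ne]
  τ₀_τ₂ x := by
    by_cases h : G.edgeOf x ∈ A <;> simp [h, edgeOf_τ₀, G.τ₀_τ₂]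

/-- The Euler genus of the spanning ribbon subgraph with edge set `A`, by Euler's formula
`γ(A) = 2 k(A) - |V| + |A| - b(A)`. -/
def eulerGenus (A : Finset (Finset G.Flag)) : ℤ :=
  2 * (graphComponents G.vertexRel A : ℤ) - (G.numVertices : ℤ) + (A.card : ℤ)
    - ((G.delete (G.edges \ A)).numBoundary : ℤ)

/-- The integer `2 ρ(A)`, where `ρ(A) = r(A) + γ(A) / 2`. -/
def twoRho (A : Finset (Finset G.Flag)) : ℤ :=
  2 * graphRank G.vertexRel A + G.eulerGenus A

/-- Moving along a vertex circle: `G.Arc x y` says that one comes from `x` to `y` by following the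
corner arc at `x`, then possibly an inert arc and the next corner arc, and so on.  If `y` is a
corner of an edge disc, the arc from `x` to `y` is the whole piece of the vertex circle between
consecutive edge discs. -/
inductive Arc : G.Flag → G.Flag → Prop
  | base (x : G.Flag) : Arc x (G.τ₁ x)
  | step (x y : G.Flag) : Arc x y → ¬ G.OnEdge y → Arc x (G.τ₁ (G.τ₂ y))

/-- The vertex of the flag `x` is isolated. -/
def Isolated (x : G.Flag) : Prop := ∀ y, G.vertexRel x y → ¬ G.OnEdge y

end RibbonGraph

/-! ## Coloured ribbon graphs -/

/-- A coloured ribbon graph: a ribbon graph with a partition of its vertices into colour classes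
and a partition of its boundary components into colour classes.  A partition of the set of
vertices (of boundary components) is given as a partition of the flags all of whose classes are
unions of vertices (of boundary components). -/
structure ColouredRibbonGraph extends RibbonGraph where
  vcol : Setoid Flag
  bcol : Setoid Flag
  vertexRel_le : toRibbonGraph.vertexRel ≤ vcol
  boundaryRel_le : toRibbonGraph.boundaryRel ≤ bcol

theorem orbitRel_le {F : Type} {f g : F → F} {s : Setoid F} (hf : ∀ x, s x (f x))
    (hg : ∀ x, s x (g x)) : orbitRel f g ≤ s := by
  apply Setoid.eqvGen_le
  rintro x y (rfl | rfl)
  · exact hf x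
  · exact hg x

theorem orbitRel_left {F : Type} (f g : F → F) (x : F) : orbitRel f g x (f x) :=
  Relation.EqvGen.rel _ _ (Or.inl rfl)

theorem orbitRel_right {F : Type} (f g : F → F) (x : F) : orbitRel f g x (g x) :=
  Relation.EqvGen.rel _ _ (Or.inr rfl)

namespace ColouredRibbonGraph

variable (G : ColouredRibbonGraph)

/-- Deletion of the edges in `A`: the vertex colours do not change, and the colour classes
of the boundary components that touch the two sides of a deleted edge are merged (and inherited by
the boundary components that arise). -/
def delete (A : Finset (Finset G.Flag)) : ColouredRibbonGraph where
  toRibbonGraph := G.toRibbonGraph.delete A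
  vcol := G.vcol
  bcol := G.bcol ⊔ joinRel A
  vertexRel_le := G.vertexRel_le
  boundaryRel_le := by
    apply orbitRel_le
    · intro x
      change (G.bcol ⊔ joinRel A) x (if G.edgeOf x ∈ A then G.τ₂ x else G.τ₀ x)
      split_ifs with h
      · exact (le_sup_right : joinRel A ≤ G.bcol ⊔ joinRel A)
          (Relation.EqvGen.rel _ _ ⟨_, h, G.self_mem_edgeOf x, G.τ₂_mem_edgeOf x⟩)
      · exact (le_sup_left : G.bcol ≤ G.bcol ⊔ joinRel A)
          (G.boundaryRel_le (orbitRel_left _ _ x))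
    · intro x
      exact (le_sup_left : G.bcol ≤ G.bcol ⊔ joinRel A)
        (G.boundaryRel_le (orbitRel_right _ _ x))

/-- Contraction of the edges in `A`: the boundary colours do not change, and the colour
classes of the ends of a contracted edge are merged (and inherited by the vertices that arise). -/
def contract (A : Finset (Finset G.Flag)) : ColouredRibbonGraph where
  toRibbonGraph := G.toRibbonGraph.contract A
  vcol := G.vcol ⊔ joinRel A
  bcol := G.bcol
  vertexRel_le := by
    apply orbitRel_le
    · intro x
      exact (le_sup_left : G.vcol ≤ G.vcol ⊔ joinRel A)
        (G.vertexRel_le (orbitRel_left _ _ x))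
    · intro x
      change (G.vcol ⊔ joinRel A) x (if G.edgeOf x ∈ A then G.τ₀ x else G.τ₂ x)
      split_ifs with h
      · exact (le_sup_right : joinRel A ≤ G.vcol ⊔ joinRel A)
          (Relation.EqvGen.rel _ _ ⟨_, h, G.self_mem_edgeOf x, G.τ₀_mem_edgeOf x⟩)
      · exact (le_sup_left : G.vcol ≤ G.vcol ⊔ joinRel A)
          (G.vertexRel_le (orbitRel_right _ _ x))
  boundaryRel_le := G.boundaryRel_le

/-- Equivalence of coloured ribbon graphs: a bijection of the corners of edge discs that preserves
the edge discs, their free and attached sides, and the pieces of the vertex circles between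
consecutive edge discs, together with compatible bijections of the vertices and of the boundary
components (including those of isolated vertices) that preserve colour classes.  Inert arcs play
no role, and reflections are allowed. -/
structure Equivalence (G H : ColouredRibbonGraph) where
  flag : {x : G.Flag // G.OnEdge x} ≃ {y : H.Flag // H.OnEdge y}
  vertex : Quotient G.vertexRel ≃ Quotient H.vertexRel
  boundary : Quotient G.boundaryRel ≃ Quotient H.boundaryRel
  map_τ₀ : ∀ x y : {x : G.Flag // G.OnEdge x},
    G.τ₀ x.1 = y.1 ↔ H.τ₀ (flag x).1 = (flag y).1
  map_τ₂ : ∀ x y : {x : G.Flag // G.OnEdge x},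
    G.τ₂ x.1 = y.1 ↔ H.τ₂ (flag x).1 = (flag y).1
  map_arc : ∀ x y : {x : G.Flag // G.OnEdge x},
    G.Arc x.1 y.1 ↔ H.Arc (flag x).1 (flag y).1
  map_vertex : ∀ x : {x : G.Flag // G.OnEdge x},
    vertex (Quotient.mk _ x.1) = Quotient.mk _ (flag x).1
  map_boundary : ∀ x : {x : G.Flag // G.OnEdge x},
    boundary (Quotient.mk _ x.1) = Quotient.mk _ (flag x).1
  map_isolated : ∀ x : G.Flag, G.Isolated x →
    ∃ y : H.Flag, H.Isolated y ∧ vertex (Quotient.mk _ x) = Quotient.mk _ y ∧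
      boundary (Quotient.mk _ x) = Quotient.mk _ y
  map_vcol : ∀ (x x' : G.Flag) (y y' : H.Flag),
    vertex (Quotient.mk _ x) = Quotient.mk _ y → vertex (Quotient.mk _ x') = Quotient.mk _ y' →
      (G.vcol x x' ↔ H.vcol y y')
  map_bcol : ∀ (x x' : G.Flag) (y y' : H.Flag),
    boundary (Quotient.mk _ x) = Quotient.mk _ y →
      boundary (Quotient.mk _ x') = Quotient.mk _ y' → (G.bcol x x' ↔ H.bcol y y')

/-- Two coloured ribbon graphs are equivalent. -/
def Equivalent (G H : ColouredRibbonGraph) : Prop := Nonempty (Equivalence G H)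

end ColouredRibbonGraph

/-- A class of coloured ribbon graphs is minor-closed if it is closed under deleting and
contracting an edge. -/
structure MinorClosed (C : Set ColouredRibbonGraph) : Prop where
  delete_mem : ∀ G ∈ C, ∀ e ∈ G.edges, G.delete {e} ∈ C
  contract_mem : ∀ G ∈ C, ∀ e ∈ G.edges, G.contract {e} ∈ C

/-! ## Edge types -/

/-- The names of the five connected coloured ribbon graphs with one edge: bridge surface, bridge
pseudo-surface, orientable loop cellular, orientable loop handle, non-orientable loop. -/
inductive Kind
  | bs
  | bp
  | olc
  | olh
  | nl

namespace ColouredRibbonGraph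

variable (G : ColouredRibbonGraph)

/-- All flags of `e` lie in the same class of `s`. -/
def OneClass {F : Type} (s : Setoid F) (e : Finset F) : Prop := ∀ x ∈ e, ∀ y ∈ e, s x y

/-- For a coloured ribbon graph whose only edge is `e`: disregarding isolated vertices, it is the
named one.
* `bs`: two vertices of different colours, joined by an edge;
* `bp`: two vertices of the same colour, joined by an edge;
* `olc`: one vertex with an orientable loop (an annulus), the two boundary components having
  different colours;
* `olh`: the same with two boundary components of the same colour;
* `nl`: one vertex with a non-orientable loop (a Möbius band, so only one boundary component). -/
def IsOneEdge (e : Finset G.Flag) : Kind → Prop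
  | .bs => G.edges = {e} ∧ ¬ OneClass G.vertexRel e ∧ ¬ OneClass G.vcol e
  | .bp => G.edges = {e} ∧ ¬ OneClass G.vertexRel e ∧ OneClass G.vcol e
  | .olc => G.edges = {e} ∧ OneClass G.vertexRel e ∧ ¬ OneClass G.boundaryRel e ∧
      ¬ OneClass G.bcol e
  | .olh => G.edges = {e} ∧ OneClass G.vertexRel e ∧ ¬ OneClass G.boundaryRel e ∧
      OneClass G.bcol e
  | .nl => G.edges = {e} ∧ OneClass G.vertexRel e ∧ OneClass G.boundaryRel e

/-- The edge `e` has type `(i, j)`: after disregarding isolated vertices, contracting all other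
edges gives `i` and deleting all other edges gives `j`. -/
def HasType (e : Finset G.Flag) (i j : Kind) : Prop :=
  (G.contract (G.edges.erase e)).IsOneEdge e i ∧ (G.delete (G.edges.erase e)).IsOneEdge e j

end ColouredRibbonGraph

/-! ## The coefficient ring and the recursion -/

/-- The variables `α, β, γ, a_bs, a_bp^{1/2}, a_olc, a_olh^{1/2}, b_bs, b_bp^{1/2}, b_olc,
b_olh^{1/2}`. -/
inductive Var
  | alpha
  | beta
  | gamma
  | aBs
  | sqrtABp
  | aOlc
  | sqrtAOlh
  | bBs
  | sqrtBBp
  | bOlc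
  | sqrtBOlh

/-- The polynomial ring over the integers in these eleven variables. -/
abbrev CoeffRing : Type := MvPolynomial Var ℤ

open MvPolynomial in
/-- The coefficients `a_i`, with `a_nl = a_bp^{1/2} a_olh^{1/2}`. -/
def coeffA : Kind → CoeffRing
  | .bs => X .aBs
  | .bp => X .sqrtABp ^ 2
  | .olc => X .aOlc
  | .olh => X .sqrtAOlh ^ 2
  | .nl => X .sqrtABp * X .sqrtAOlh

open MvPolynomial in
/-- The coefficients `b_j`, with `b_nl = b_bp^{1/2} b_olh^{1/2}`. -/
def coeffB : Kind → CoeffRing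
  | .bs => X .bBs
  | .bp => X .sqrtBBp ^ 2
  | .olc => X .bOlc
  | .olh => X .sqrtBOlh ^ 2
  | .nl => X .sqrtBBp * X .sqrtBOlh

open MvPolynomial in
/-- The deletion-contraction recursion for a map `U` on a minor-closed class: it holds for every
edge of every member of the class, and the values on edgeless members are prescribed. -/
structure SatisfiesRecursion {C : Set ColouredRibbonGraph} (hC : MinorClosed C)
    (U : C → CoeffRing) : Prop where
  edge : ∀ (G : C) (e : Finset G.1.Flag) (he : e ∈ G.1.edges) (i j : Kind),
    G.1.HasType e i j →
      U G = coeffA i * U ⟨G.1.delete {e}, hC.delete_mem G.1 G.2 e he⟩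
        + coeffB j * U ⟨G.1.contract {e}, hC.contract_mem G.1 G.2 e he⟩
  edgeless : ∀ G : C, G.1.edges = ∅ →
    U G = X .alpha ^ numClasses G.1.vcol * X .beta ^ numClasses G.1.bcol
      * X .gamma ^ G.1.numVertices

/-! ## The polynomial `T_ps` -/

namespace ColouredRibbonGraph

variable (G : ColouredRibbonGraph)

/-- `r₁(A)`, the rank of `A` in the graph `G/𝒱` on the vertex colour classes. -/
def r₁ (A : Finset (Finset G.Flag)) : ℤ := graphRank G.vcol A

/-- `2 r₂(A)`, where `r₂(A) = ρ(A) - r₁(A)`. -/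
def twoR₂ (A : Finset (Finset G.Flag)) : ℤ := G.twoRho A - 2 * G.r₁ A

/-- `r₃(A) = r(E) - r(Aᶜ)`, for the rank function of the graph `G*/ℬ` on the boundary colour
classes, in which every edge joins the colour classes of the boundary components at its sides. -/
def r₃ (A : Finset (Finset G.Flag)) : ℤ :=
  graphRank G.bcol G.edges - graphRank G.bcol (G.edges \ A)

/-- `2 r₄(A)`, where `r₄(A) = |A| + r(Aᶜ) - r(E) - ρ(A)`, for the rank function of `G*/ℬ`. -/
def twoR₄ (A : Finset (Finset G.Flag)) : ℤ :=
  2 * ((A.card : ℤ) + graphRank G.bcol (G.edges \ A) - graphRank G.bcol G.edges) - G.twoRho A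

/-- The value of `T_ps(G; w, x, y, z) = ∑_A w^(r₁(E)-r₁(A)) x^(r₂(E)-r₂(A)) y^(r₃(A)) z^(r₄(A))`
at elements of a field, where `sx` and `sz` are the chosen square roots of `x` and `z`. -/
def Tps {K : Type*} [Field K] (w sx y sz : K) : K :=
  ∑ A ∈ G.edges.powerset,
    w ^ (G.r₁ G.edges - G.r₁ A) * sx ^ (G.twoR₂ G.edges - G.twoR₂ A) * y ^ G.r₃ A
      * sz ^ G.twoR₄ A

open MvPolynomial in
/-- The right-hand side of the universality formula, in a field `K` that contains the coefficient
ring; `g` is a square root of `γ` in `K`. -/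
def universalValue (K : Type*) [Field K] [Algebra CoeffRing K] (g : K) : K :=
  let c : Var → K := fun t => algebraMap CoeffRing K (X t)
  c .alpha ^ graphComponents G.vcol G.edges * c .beta ^ graphComponents G.bcol G.edges
    * g ^ (2 * (G.numVertices : ℤ) - G.twoRho G.edges)
    * c .bBs ^ G.r₁ G.edges * c .sqrtBBp ^ G.twoR₂ G.edges
    * c .aOlc ^ G.r₃ G.edges * c .sqrtAOlh ^ G.twoR₄ G.edges
    * G.Tps (c .alpha * c .gamma * c .aBs / c .bBs)
        (g * c .sqrtABp / c .sqrtBBp)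
        (c .beta * c .gamma * c .bOlc / c .aOlc)
        (g * c .sqrtBOlh / c .sqrtAOlh)

end ColouredRibbonGraph

end RibbonTutte

end

namespace RibbonTutte

/-! ## Counting classes -/

/-! The recursion is solved by an explicit state sum over `A ⊆ E`. Contracting `A` and deleting the
rest leaves an edgeless graph, whose value is `stateBase A`. The contractions contribute the
`b`-monomial of the step from `∅` to `A`, the deletions the `a`-monomial of the step from `A` to
`E`.

These monomials are well defined because the kind of an edge is numerical. When `e` is added to `A`,
record the changes in `|A|`, in the components of `G/𝒱`, in the boundary components of `(V, A)`, and
in the components of `G*/ℬ` with edge set `Aᶜ`. This vector, a `Jump`, determines the kind, and the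
coefficient of the kind is a monomial whose exponents are linear in it (`ofJump_edgeJump`). Jumps
add along chains, so monomials multiply (`ofJump_add`) and the order of the edges is irrelevant. The
kind of `e` in `G/eᶜ` is read off the last step `E \ e → E`, the kind in `G\eᶜ` off the first step
`∅ → {e}`. Splitting the sum according to whether `e ∈ A` therefore gives the recursion
(`HasType.stateSum_eq`). Every edge has a type, so induction on the number of edges gives
uniqueness.

The topological input is that an edge cannot turn two boundary components into two others: of `(V,
A)` and `(V, A ∪ e)`, at least one has all four corners of `e` on one boundary component
(`oneClass_subRel`). This is a parity argument (`oneClass_or_oneClass_of_switch`), and it makes all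
exponents nonnegative. Minors are controlled by the duality `contractτ₂_eq_deleteτ₀`: the vertices
of `G/A` are the boundary components of `(V, A)`.

The formula with `T_ps` holds term by term, since `2ρ(A) = |V| + |A| - b(A)`. Invariance under
equivalence holds because all the counts in the state sum are invariants. -/

theorem joinRel_rel {F : Type} {A : Finset (Finset F)} {e : Finset F} (he : e ∈ A) {x y : F}
    (hx : x ∈ e) (hy : y ∈ e) : joinRel A x y :=
  Relation.EqvGen.rel _ _ ⟨e, he, hx, hy⟩

theorem joinRel_le {F : Type} {A : Finset (Finset F)} {s : Setoid F}
    (h : ∀ e ∈ A, ∀ x ∈ e, ∀ y ∈ e, s x y) : joinRel A ≤ s := by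
  apply Setoid.eqvGen_le
  rintro x y ⟨e, he, hx, hy⟩
  exact h e he x hx y hy

theorem joinRel_mono {F : Type} {A B : Finset (Finset F)} (h : A ⊆ B) :
    joinRel A ≤ joinRel B :=
  joinRel_le fun _ he _ hx _ hy => joinRel_rel (h he) hx hy

theorem joinRel_empty {F : Type} : joinRel (∅ : Finset (Finset F)) = ⊥ :=
  le_bot_iff.1 (joinRel_le fun e he => by simp at he)

theorem joinRel_union {F : Type} [DecidableEq F] (A B : Finset (Finset F)) :
    joinRel (A ∪ B) = joinRel A ⊔ joinRel B := by
  apply le_antisymm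
  · apply joinRel_le
    intro e he x hx y hy
    rcases Finset.mem_union.1 he with h | h
    · exact (le_sup_left : joinRel A ≤ joinRel A ⊔ joinRel B) (joinRel_rel h hx hy)
    · exact (le_sup_right : joinRel B ≤ joinRel A ⊔ joinRel B) (joinRel_rel h hx hy)
  · exact sup_le (joinRel_mono Finset.subset_union_left) (joinRel_mono Finset.subset_union_right)

theorem orbitRel_comm {F : Type} (f g : F → F) : orbitRel f g = orbitRel g f :=
  le_antisymm (orbitRel_le (orbitRel_right g f) (orbitRel_left g f))
    (orbitRel_le (orbitRel_right f g) (orbitRel_left f g))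

open ColouredRibbonGraph (OneClass)

theorem ColouredRibbonGraph.OneClass.mono {F : Type} {s t : Setoid F} (h : s ≤ t) {e : Finset F}
    (hs : OneClass s e) : OneClass t e :=
  fun x hx y hy => h (hs x hx y hy)

open Classical in
/-- Merging the classes that meet `e`, of which there are at most two, lowers the number of
classes by one or by zero. -/
theorem numClasses_eq_sup_joinRel_add {F : Type} [Finite F] (s : Setoid F) {e : Finset F}
    {x y : F} (hx : x ∈ e) (hy : y ∈ e) (h : ∀ z ∈ e, s z x ∨ s z y) :
    numClasses s = numClasses (s ⊔ joinRel {e}) + if OneClass s e then 0 else 1 := by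
  split_ifs with h1
  · have : joinRel {e} ≤ s := joinRel_le fun e' he' a ha b hb => by
      rw [Finset.mem_singleton] at he'
      subst he'
      exact h1 a ha b hb
    rw [sup_eq_left.2 this, add_zero]
  have hxy : ¬ s x y := by
    intro hxy
    have key : ∀ z ∈ e, s z x := fun z hz =>
      (h z hz).elim id fun h' => s.trans' h' (s.symm' hxy)
    exact h1 fun a ha b hb => s.trans' (key a ha) (s.symm' (key b hb))
  set u := s ⊔ joinRel {e} with hu
  have hsu : s ≤ u := le_sup_left
  let P : F → Prop := fun a => s a x ∨ s a y
  have hP : ∀ {a b}, s a b → P b → P a := fun hab hb =>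
    hb.elim (fun h => Or.inl (s.trans' hab h)) fun h => Or.inr (s.trans' hab h)
  -- An explicit relation above `u` that merges just the classes of `x` and `y`; it bounds what `u`
  -- can identify.
  let u' : Setoid F :=
    { r := fun a b => s a b ∨ (P a ∧ P b)
      iseqv :=
        { refl := fun a => Or.inl (s.refl' a)
          symm := by
            rintro a b (h | h)
            · exact Or.inl (s.symm' h)
            · exact Or.inr h.symm
          trans := by
            rintro a b c (hab | hab) (hbc | hbc)
            · exact Or.inl (s.trans' hab hbc)
            · exact Or.inr ⟨hP hab hbc.1, hbc.2⟩
            · exact Or.inr ⟨hab.1, hP (s.symm' hbc) hab.2⟩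
            · exact Or.inr ⟨hab.1, hbc.2⟩ } }
  have huu' : u ≤ u' := by
    refine sup_le (fun a b hab => Or.inl hab) (joinRel_le ?_)
    intro e' he' a ha b hb
    rw [Finset.mem_singleton] at he'
    subst he'
    exact Or.inr ⟨h a ha, h b hb⟩
  have huxy : u x y :=
    (le_sup_right : joinRel {e} ≤ u) (joinRel_rel (Finset.mem_singleton_self e) hx hy)
  -- The class of `y` is omitted because it is absorbed by the class of `x`; all other classes of
  -- `s` survive separately.
  let φ : {q : Quotient s // q ≠ Quotient.mk s y} → Quotient u :=
    fun q => Quotient.map' (s₁ := s) (s₂ := u) id (fun a b hab => hsu hab) q.1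
  have hφ : Function.Bijective φ := by
    constructor
    · rintro ⟨q, hq⟩ ⟨q', hq'⟩ heq
      induction q using Quotient.inductionOn with | h a => ?_
      induction q' using Quotient.inductionOn with | h b => ?_
      have hab : u a b := Quotient.exact heq
      have hay : ¬ s a y := fun h => hq (Quotient.sound h)
      have hby : ¬ s b y := fun h => hq' (Quotient.sound h)
      have : s a b := by
        rcases huu' hab with h | ⟨h1, h2⟩
        · exact h
        · exact s.trans' (h1.resolve_right hay) (s.symm' (h2.resolve_right hby))
      exact Subtype.ext (Quotient.sound this)
    · intro q
      induction q using Quotient.inductionOn with | h a => ?_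
      by_cases ha : s a y
      · exact ⟨⟨Quotient.mk s x, fun h => hxy (Quotient.exact h)⟩,
          Quotient.sound (u.trans' huxy (u.symm' (hsu ha)))⟩
      · exact ⟨⟨Quotient.mk s a, fun h => ha (Quotient.exact h)⟩, rfl⟩
  have hcard : Nat.card {q : Quotient s // q ≠ Quotient.mk s y} = numClasses u :=
    Nat.card_eq_of_bijective φ hφ
  have := Fintype.ofFinite (Quotient s)
  rw [← hcard, numClasses, Nat.card_eq_fintype_card, Nat.card_eq_fintype_card,
    Fintype.card_subtype_compl, Fintype.card_subtype_eq]
  have : 0 < Fintype.card (Quotient s) := Fintype.card_pos_iff.2 ⟨Quotient.mk s y⟩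
  omega

/-- A correspondence between the elements of two sets that reaches all classes and respects two
equivalence relations shows that these have equally many classes. -/
theorem numClasses_eq_of_correspondence {F F' : Type} {s : Setoid F} {t : Setoid F'}
    (Φ : F → F' → Prop) (hl : ∀ x, ∃ x' y, s x x' ∧ Φ x' y) (hr : ∀ y, ∃ y' x, t y y' ∧ Φ x y')
    (hst : ∀ x x' y y', Φ x y → Φ x' y' → (s x x' ↔ t y y')) :
    numClasses s = numClasses t := by
  choose a b hsa hab using hl
  let φ : Quotient s → Quotient t := Quotient.map' (s₁ := s) (s₂ := t) b (by
    intro x x' hx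
    exact (hst _ _ _ _ (hab x) (hab x')).1
      (s.trans' (s.symm' (hsa x)) (s.trans' hx (hsa x'))))
  refine Nat.card_eq_of_bijective φ ⟨?_, ?_⟩
  · intro q q' heq
    induction q using Quotient.inductionOn with | h x => ?_
    induction q' using Quotient.inductionOn with | h x' => ?_
    have : t (b x) (b x') := Quotient.exact heq
    exact Quotient.sound (s.trans' (hsa x)
      (s.trans' ((hst _ _ _ _ (hab x) (hab x')).2 this) (s.symm' (hsa x'))))
  · intro q
    induction q using Quotient.inductionOn with | h y => ?_
    obtain ⟨y', x, hy, hx⟩ := hr y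
    refine ⟨Quotient.mk s x, Quotient.sound ?_⟩
    exact t.trans' ((hst _ _ _ _ (hab x) hx).1 (s.symm' (hsa x))) (t.symm' hy)

/-! ## Changing an involution on four points -/

theorem even_card_of_involution {F : Type} [DecidableEq F] (S : Finset F) (f : F → F)
    (hf : ∀ x, f (f x) = x) (hne : ∀ x, f x ≠ x) (hS : ∀ x ∈ S, f x ∈ S) : Even S.card := by
  rw [← ZMod.natCast_eq_zero_iff_even, Finset.cast_card]
  exact Finset.sum_involution (fun a _ => f a) (fun _ _ => by decide) (fun a _ _ => hne a)
    (fun a ha => hS a ha) (fun a _ => hf a)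

/-- If two involutions induce different pairings on four points and agree elsewhere, then the four
points lie in one orbit for at least one of them, whatever the second generator is. -/
theorem oneClass_or_oneClass_of_switch {F : Type} [Fintype F] [DecidableEq F] {f f' g : F → F}
    {x₀ x₁ x₂ x₃ : F} (hf : ∀ x, f (f x) = x) (hfne : ∀ x, f x ≠ x)
    (hg : ∀ x, g (g x) = x) (hgne : ∀ x, g x ≠ x)
    (h01 : f x₀ = x₁) (h23 : f x₂ = x₃) (h02 : f' x₀ = x₂) (h13 : f' x₁ = x₃)
    (hne1 : x₁ ≠ x₀) (hne2 : x₂ ≠ x₀) (hne3 : x₃ ≠ x₀)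
    (hff' : ∀ x, x ∉ ({x₀, x₁, x₂, x₃} : Finset F) → f x = f' x) :
    OneClass (orbitRel f g) {x₀, x₁, x₂, x₃} ∨ OneClass (orbitRel f' g) {x₀, x₁, x₂, x₃} := by
  classical
  set e : Finset F := {x₀, x₁, x₂, x₃} with he
  -- The orbits after cutting at the four points. Both orbit relations contain `p`, since `f` and
  -- `f'` agree off `e`.
  let p : Setoid F := Relation.EqvGen.setoid fun x y => y = g x ∨ (x ∉ e ∧ y = f x)
  have hpg : ∀ x, p x (g x) := fun x => Relation.EqvGen.rel _ _ (Or.inl rfl)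
  have hpf : ∀ x, x ∉ e → p x (f x) := fun x hx => Relation.EqvGen.rel _ _ (Or.inr ⟨hx, rfl⟩)
  have hpt : p ≤ orbitRel f g := by
    apply Setoid.eqvGen_le
    rintro x y (rfl | ⟨_, rfl⟩)
    · exact orbitRel_right f g x
    · exact orbitRel_left f g x
  have hps : p ≤ orbitRel f' g := by
    apply Setoid.eqvGen_le
    rintro x y (rfl | ⟨hx, rfl⟩)
    · exact orbitRel_right f' g x
    · rw [hff' x hx]
      exact orbitRel_left f' g x
  -- Parity: `g` pairs off the `p`-class of `x₀`. If the class contained no other point of `e`, then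
  -- `f` would pair off the class without `x₀`, so its size would be both even and odd.
  have key : p x₀ x₁ ∨ p x₀ x₂ ∨ p x₀ x₃ := by
    by_contra! hcon
    let S : Finset F := Finset.univ.filter fun z => p x₀ z
    have h1 : Even S.card := by
      refine even_card_of_involution S g hg hgne fun x hx => ?_
      simp only [S, Finset.mem_filter, Finset.mem_univ, true_and] at hx ⊢
      exact p.trans' hx (hpg x)
    have h2 : Even (S.erase x₀).card := by
      refine even_card_of_involution _ f hf hfne fun x hx => ?_
      simp only [S, Finset.mem_erase, Finset.mem_filter, Finset.mem_univ, true_and] at hx ⊢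
      have hxe : x ∉ e := by
        simp only [he, Finset.mem_insert, Finset.mem_singleton, not_or]
        refine ⟨hx.1, ?_, ?_, ?_⟩
        · rintro rfl; exact hcon.1 hx.2
        · rintro rfl; exact hcon.2.1 hx.2
        · rintro rfl; exact hcon.2.2 hx.2
      refine ⟨?_, p.trans' hx.2 (hpf x hxe)⟩
      intro hfx
      apply hxe
      rw [← hf x, hfx, h01]
      simp [he]
    have hx0 : x₀ ∈ S := by
      simp only [S, Finset.mem_filter, Finset.mem_univ, true_and]
      exact p.refl' x₀
    rw [Finset.card_erase_of_mem hx0] at h2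
    have hpos : 0 < S.card := Finset.card_pos.2 ⟨x₀, hx0⟩
    obtain ⟨a, ha⟩ := h1
    obtain ⟨b, hb⟩ := h2
    omega
  have one : ∀ t : Setoid F, t x₀ x₁ → t x₀ x₂ → t x₀ x₃ → OneClass t e := by
    intro t h1 h2 h3
    have : ∀ z ∈ e, t x₀ z := by
      intro z hz
      simp only [he, Finset.mem_insert, Finset.mem_singleton] at hz
      rcases hz with rfl | rfl | rfl | rfl
      exacts [t.refl' _, h1, h2, h3]
    exact fun a ha b hb => t.trans' (t.symm' (this a ha)) (this b hb)
  set t := orbitRel f g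
  set s := orbitRel f' g
  have t01 : t x₀ x₁ := h01 ▸ orbitRel_left f g x₀
  have t23 : t x₂ x₃ := h23 ▸ orbitRel_left f g x₂
  have s02 : s x₀ x₂ := h02 ▸ orbitRel_left f' g x₀
  have s13 : s x₁ x₃ := h13 ▸ orbitRel_left f' g x₁
  rcases key with h | h | h
  · exact Or.inr (one s (hps h) s02 (s.trans' (hps h) s13))
  · exact Or.inl (one t t01 (hpt h) (t.trans' (hpt h) t23))
  · exact Or.inl (one t t01 (t.trans' (hpt h) (t.symm' t23)) (hpt h))

/-- Once `e` is merged into one class, the action of the involution inside `e` carries no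
information. -/
theorem orbitRel_sup_joinRel_le {F : Type} {f f' g : F → F} {e : Finset F} (hfe : ∀ x ∈ e, f x ∈ e)
    (hff' : ∀ x, x ∉ e → f x = f' x) :
    orbitRel f g ⊔ joinRel {e} ≤ orbitRel f' g ⊔ joinRel {e} := by
  refine sup_le (orbitRel_le (fun x => ?_) fun x => ?_) le_sup_right
  · by_cases hx : x ∈ e
    · exact (le_sup_right : joinRel {e} ≤ orbitRel f' g ⊔ joinRel {e})
        (joinRel_rel (Finset.mem_singleton_self e) hx (hfe x hx))
    · rw [hff' x hx]
      exact (le_sup_left : orbitRel f' g ≤ orbitRel f' g ⊔ joinRel {e}) (orbitRel_left f' g x)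
  · exact (le_sup_left : orbitRel f' g ≤ orbitRel f' g ⊔ joinRel {e}) (orbitRel_right f' g x)

end RibbonTutte

namespace RibbonTutte

open ColouredRibbonGraph (OneClass)

/-! ## Edges of minors -/

namespace RibbonGraph

variable (G : RibbonGraph)

theorem onEdge_τ₀ {x : G.Flag} : G.OnEdge (G.τ₀ x) ↔ G.OnEdge x := by
  unfold OnEdge
  rw [not_iff_not, G.τ₀_τ₀, ← G.τ₀_τ₂]
  constructor
  · intro h
    rw [h, G.τ₀_τ₀, ← h]
  · intro h
    rw [← h, G.τ₀_τ₀]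

theorem onEdge_τ₂ {x : G.Flag} : G.OnEdge (G.τ₂ x) ↔ G.OnEdge x := by
  unfold OnEdge
  rw [not_iff_not, G.τ₂_τ₂, G.τ₀_τ₂]
  constructor
  · intro h
    rw [← G.τ₂_τ₂ (G.τ₀ x), h]
  · intro h
    rw [h, G.τ₂_τ₂]

theorem edgeOf_eq_of_mem {x y : G.Flag} (h : y ∈ G.edgeOf x) : G.edgeOf y = G.edgeOf x := by
  simp only [edgeOf, Finset.mem_insert, Finset.mem_singleton] at h
  rcases h with rfl | rfl | rfl | rfl
  · rfl
  · exact G.edgeOf_τ₀ x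
  · exact G.edgeOf_τ₂ x
  · rw [G.edgeOf_τ₀, G.edgeOf_τ₂]

theorem onEdge_of_mem_edgeOf {x y : G.Flag} (h : y ∈ G.edgeOf x) (hx : G.OnEdge x) :
    G.OnEdge y := by
  simp only [edgeOf, Finset.mem_insert, Finset.mem_singleton] at h
  rcases h with rfl | rfl | rfl | rfl
  · exact hx
  · exact G.onEdge_τ₀.2 hx
  · exact G.onEdge_τ₂.2 hx
  · exact G.onEdge_τ₀.2 (G.onEdge_τ₂.2 hx)

theorem mem_edges {e : Finset G.Flag} : e ∈ G.edges ↔ ∃ x, G.OnEdge x ∧ G.edgeOf x = e := by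
  simp [edges]

theorem edgeOf_mem_edges {x : G.Flag} : G.edgeOf x ∈ G.edges ↔ G.OnEdge x := by
  rw [mem_edges]
  constructor
  · rintro ⟨y, hy, h⟩
    exact G.onEdge_of_mem_edgeOf (h ▸ G.self_mem_edgeOf x) hy
  · exact fun h => ⟨x, h, rfl⟩

theorem τ₀_eq_τ₂ {x : G.Flag} (h : ¬ G.OnEdge x) : G.τ₀ x = G.τ₂ x := not_not.1 h

theorem edgeOf_eq_of_mem_edges {e : Finset G.Flag} (he : e ∈ G.edges) {x : G.Flag} (hx : x ∈ e) :
    G.edgeOf x = e := by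
  obtain ⟨y, -, rfl⟩ := G.mem_edges.1 he
  exact G.edgeOf_eq_of_mem hx

/-- The involution `τ₀` of `G.delete A`, as a function on the flags of `G`. -/
def deleteτ₀ (A : Finset (Finset G.Flag)) (x : G.Flag) : G.Flag :=
  if G.edgeOf x ∈ A then G.τ₂ x else G.τ₀ x

/-- The involution `τ₂` of `G.contract A`, as a function on the flags of `G`. -/
def contractτ₂ (A : Finset (Finset G.Flag)) (x : G.Flag) : G.Flag :=
  if G.edgeOf x ∈ A then G.τ₀ x else G.τ₂ x

/-- The edge of a flag in `G.delete A`, as a set of flags of `G`. -/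
def deleteEdgeOf (A : Finset (Finset G.Flag)) (x : G.Flag) : Finset G.Flag :=
  (G.delete A).edgeOf x

/-- The edge of a flag in `G.contract A`, as a set of flags of `G`. -/
def contractEdgeOf (A : Finset (Finset G.Flag)) (x : G.Flag) : Finset G.Flag :=
  (G.contract A).edgeOf x

/-- The edges of `G.delete A`, as sets of flags of `G`. -/
def deleteEdges (A : Finset (Finset G.Flag)) : Finset (Finset G.Flag) := (G.delete A).edges

/-- The edges of `G.contract A`, as sets of flags of `G`. -/
def contractEdges (A : Finset (Finset G.Flag)) : Finset (Finset G.Flag) := (G.contract A).edges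

theorem deleteEdgeOf_eq {A : Finset (Finset G.Flag)} {x : G.Flag} (h : G.edgeOf x ∉ A) :
    G.deleteEdgeOf A x = G.edgeOf x := by
  have h' : G.edgeOf (G.τ₂ x) ∉ A := by rwa [G.edgeOf_τ₂]
  change ({x, G.deleteτ₀ A x, G.τ₂ x, G.deleteτ₀ A (G.τ₂ x)} : Finset G.Flag) = _
  rw [deleteτ₀, deleteτ₀, if_neg h, if_neg h']
  rfl

theorem contractEdgeOf_eq {A : Finset (Finset G.Flag)} {x : G.Flag} (h : G.edgeOf x ∉ A) :
    G.contractEdgeOf A x = G.edgeOf x := by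
  change ({x, G.τ₀ x, G.contractτ₂ A x, G.τ₀ (G.contractτ₂ A x)} : Finset G.Flag) = _
  rw [contractτ₂, if_neg h]
  rfl

theorem delete_onEdge {A : Finset (Finset G.Flag)} {x : G.Flag} :
    (G.delete A).OnEdge x ↔ G.OnEdge x ∧ G.edgeOf x ∉ A := by
  change G.deleteτ₀ A x ≠ G.τ₂ x ↔ G.τ₀ x ≠ G.τ₂ x ∧ _
  rw [deleteτ₀]
  split_ifs with h <;> simp [h]

theorem contract_onEdge {A : Finset (Finset G.Flag)} {x : G.Flag} :
    (G.contract A).OnEdge x ↔ G.OnEdge x ∧ G.edgeOf x ∉ A := by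
  change G.τ₀ x ≠ G.contractτ₂ A x ↔ G.τ₀ x ≠ G.τ₂ x ∧ _
  rw [contractτ₂]
  split_ifs with h <;> simp [h]

theorem mem_deleteEdges {A : Finset (Finset G.Flag)} {e : Finset G.Flag} :
    e ∈ G.deleteEdges A ↔ ∃ x, (G.OnEdge x ∧ G.edgeOf x ∉ A) ∧ G.deleteEdgeOf A x = e :=
  ((G.delete A).mem_edges).trans (exists_congr fun _ => and_congr_left' G.delete_onEdge)

theorem mem_contractEdges {A : Finset (Finset G.Flag)} {e : Finset G.Flag} :
    e ∈ G.contractEdges A ↔ ∃ x, (G.OnEdge x ∧ G.edgeOf x ∉ A) ∧ G.contractEdgeOf A x = e :=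
  ((G.contract A).mem_edges).trans (exists_congr fun _ => and_congr_left' G.contract_onEdge)

theorem deleteEdges_eq (A : Finset (Finset G.Flag)) : G.deleteEdges A = G.edges \ A := by
  ext e
  rw [Finset.mem_sdiff, mem_deleteEdges, mem_edges]
  constructor
  · rintro ⟨x, ⟨h1, h2⟩, rfl⟩
    rw [G.deleteEdgeOf_eq h2]
    exact ⟨⟨x, h1, rfl⟩, h2⟩
  · rintro ⟨⟨x, hx, rfl⟩, h⟩
    exact ⟨x, ⟨hx, h⟩, G.deleteEdgeOf_eq h⟩

theorem contractEdges_eq (A : Finset (Finset G.Flag)) : G.contractEdges A = G.edges \ A := by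
  ext e
  rw [Finset.mem_sdiff, mem_contractEdges, mem_edges]
  constructor
  · rintro ⟨x, ⟨h1, h2⟩, rfl⟩
    rw [G.contractEdgeOf_eq h2]
    exact ⟨⟨x, h1, rfl⟩, h2⟩
  · rintro ⟨⟨x, hx, rfl⟩, h⟩
    exact ⟨x, ⟨hx, h⟩, G.contractEdgeOf_eq h⟩

theorem delete_deleteτ₀ (A B : Finset (Finset G.Flag)) :
    @Eq (G.Flag → G.Flag) ((G.delete A).deleteτ₀ B) (G.deleteτ₀ (A ∪ B)) := by
  funext x
  change G.Flag at x
  change (if G.deleteEdgeOf A x ∈ B then G.τ₂ x else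
    if G.edgeOf x ∈ A then G.τ₂ x else G.τ₀ x) = if G.edgeOf x ∈ A ∪ B then G.τ₂ x else G.τ₀ x
  by_cases h : G.edgeOf x ∈ A
  · simp [h]
  · simp [h, G.deleteEdgeOf_eq h]

theorem contract_deleteτ₀ {A B : Finset (Finset G.Flag)} (hB : B ⊆ G.edges)
    (hAB : Disjoint A B) :
    @Eq (G.Flag → G.Flag) ((G.contract A).deleteτ₀ B) (G.deleteτ₀ B) := by
  funext x
  change G.Flag at x
  change (if G.contractEdgeOf A x ∈ B then (if G.edgeOf x ∈ A then G.τ₀ x else G.τ₂ x)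
    else G.τ₀ x) = if G.edgeOf x ∈ B then G.τ₂ x else G.τ₀ x
  by_cases h : G.edgeOf x ∈ A
  · have h1 : G.edgeOf x ∉ B := Finset.disjoint_left.1 hAB h
    -- The orbit of a flag on a contracted edge is an inert pair, hence not an edge of `G.contract
    -- A`, whereas every member of `B` is one.
    have h2 : G.contractEdgeOf A x ∉ B := by
      intro h'
      have h3 : G.contractEdgeOf A x ∈ G.contractEdges A := by
        rw [contractEdges_eq, Finset.mem_sdiff]
        exact ⟨hB h', Finset.disjoint_right.1 hAB h'⟩
      exact (G.contract_onEdge.1 ((G.contract A).edgeOf_mem_edges.1 h3)).2 h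
    simp [h1, h2]
  · simp [h, G.contractEdgeOf_eq h]

/-- On edges in `A` both sides are `τ₀`, on the other edges both are `τ₂`, and on inert arcs the two
involutions agree. Thus the vertex circles of `G/A` are the boundary curves of `(V, A)`. -/
theorem contractτ₂_eq_deleteτ₀ (A : Finset (Finset G.Flag)) :
    G.contractτ₂ A = G.deleteτ₀ (G.edges \ A) := by
  funext x
  rw [contractτ₂, deleteτ₀]
  by_cases h : G.edgeOf x ∈ A
  · simp [h]
  · by_cases hx : G.OnEdge x
    · simp [h, G.edgeOf_mem_edges.2 hx]
    · simp [h, G.τ₀_eq_τ₂ hx]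

/-- The boundary components of the spanning ribbon subgraph with edge set `A`. -/
def subRel (A : Finset (Finset G.Flag)) : Setoid G.Flag := (G.delete (G.edges \ A)).boundaryRel

theorem subRel_eq (A : Finset (Finset G.Flag)) :
    G.subRel A = orbitRel (G.deleteτ₀ (G.edges \ A)) G.τ₁ := rfl

theorem contract_vertexRel (A : Finset (Finset G.Flag)) :
    (G.contract A).vertexRel = G.subRel A := by
  change orbitRel G.τ₁ (G.contractτ₂ A) = _
  rw [contractτ₂_eq_deleteτ₀, orbitRel_comm, subRel_eq]

theorem subRel_edges : G.subRel G.edges = G.boundaryRel := by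
  have : G.deleteτ₀ (G.edges \ G.edges) = G.τ₀ := by funext x; simp [deleteτ₀]
  rw [subRel_eq, this]
  rfl

theorem subRel_empty : G.subRel ∅ = G.vertexRel := by
  have : G.contractτ₂ ∅ = G.τ₂ := by funext x; simp [contractτ₂]
  rw [subRel_eq, ← contractτ₂_eq_deleteτ₀, this, orbitRel_comm]
  rfl

/-- The number of boundary components of the spanning ribbon subgraph with edge set `A`. -/
noncomputable def subBoundary (A : Finset (Finset G.Flag)) : ℕ := (G.delete (G.edges \ A)).numBoundary

theorem subBoundary_empty : G.subBoundary ∅ = G.numVertices := by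
  change numClasses (G.subRel ∅) = _
  rw [subRel_empty]
  rfl

/-- The number of components cancels between `2r(A)` and the Euler genus. The number of vertices is
written as `b(∅)`, so that only boundary counts remain. -/
theorem twoRho_eq (A : Finset (Finset G.Flag)) :
    G.twoRho A = G.subBoundary ∅ + A.card - G.subBoundary A := by
  rw [twoRho, eulerGenus, graphRank, subBoundary_empty, numVertices, subBoundary]
  ring

end RibbonGraph

/-! ## Adding an edge to a spanning ribbon subgraph -/

/-- The part of the definition of the kind of an edge `e` that refers to the vertices `s`, the
vertex colours `v`, the boundary components `t` and the boundary colours `b`. -/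
def IsKind {F : Type} (s v t b : Setoid F) (e : Finset F) : Kind → Prop
  | .bs => ¬ OneClass s e ∧ ¬ OneClass v e
  | .bp => ¬ OneClass s e ∧ OneClass v e
  | .olc => OneClass s e ∧ ¬ OneClass t e ∧ ¬ OneClass b e
  | .olh => OneClass s e ∧ ¬ OneClass t e ∧ OneClass b e
  | .nl => OneClass s e ∧ OneClass t e

theorem exists_isKind {F : Type} (s v t b : Setoid F) (e : Finset F) :
    ∃ i, IsKind s v t b e i := by
  by_cases hs : OneClass s e
  · by_cases ht : OneClass t e
    · exact ⟨.nl, hs, ht⟩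
    · by_cases hb : OneClass b e
      · exact ⟨.olh, hs, ht, hb⟩
      · exact ⟨.olc, hs, ht, hb⟩
  · by_cases hv : OneClass v e
    · exact ⟨.bp, hs, hv⟩
    · exact ⟨.bs, hs, hv⟩

/-- A choice of the coefficients of the five kinds, where those of `bp` and `olh` are given by
their square roots. -/
structure Weights (R : Type*) where
  bs : R
  sqrtBp : R
  olc : R
  sqrtOlh : R

/-- The coefficient of a kind. -/
def Weights.ofKind {R : Type*} [CommMonoid R] (w : Weights R) : Kind → R
  | .bs => w.bs
  | .bp => w.sqrtBp ^ 2
  | .olc => w.olc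
  | .olh => w.sqrtOlh ^ 2
  | .nl => w.sqrtBp * w.sqrtOlh

/-- The change in a pair of nested edge sets of the data that enter the state sum: the number of
edges added, the number of components of `G/𝒱` lost, the number of boundary components gained, and
the number of components of `G*/ℬ` gained. -/
@[ext]
structure Jump where
  size : ℤ
  vert : ℤ
  bdry : ℤ
  dual : ℤ

namespace Jump

/-- The exponents that belong to the jump are nonnegative. -/
structure Nonneg (j : Jump) : Prop where
  bs : 0 ≤ j.vert
  bp : 0 ≤ j.size - j.bdry - 2 * j.vert
  olc : 0 ≤ j.dual
  olh : 0 ≤ j.size + j.bdry - 2 * j.dual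

/-- The sum of two jumps. -/
def add (j k : Jump) : Jump :=
  ⟨j.size + k.size, j.vert + k.vert, j.bdry + k.bdry, j.dual + k.dual⟩

theorem Nonneg.add {j k : Jump} (hj : j.Nonneg) (hk : k.Nonneg) : (j.add k).Nonneg := by
  obtain ⟨h1, h2, h3, h4⟩ := hj
  obtain ⟨k1, k2, k3, k4⟩ := hk
  constructor <;> simp only [Jump.add] <;> omega

end Jump

/-- The monomial that belongs to a jump. -/
def Weights.ofJump {R : Type*} [CommMonoid R] (w : Weights R) (j : Jump) : R :=
  w.bs ^ j.vert.toNat * w.sqrtBp ^ (j.size - j.bdry - 2 * j.vert).toNat * w.olc ^ j.dual.toNat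
    * w.sqrtOlh ^ (j.size + j.bdry - 2 * j.dual).toNat

theorem mul_four_mul_comm {M : Type*} [CommMonoid M] (a b c d a' b' c' d' : M) :
    a * a' * (b * b') * (c * c') * (d * d') = a * b * c * d * (a' * b' * c' * d') := by
  rw [mul_mul_mul_comm a a' b b', mul_mul_mul_comm (a * b) (a' * b') c c',
    mul_mul_mul_comm (a * b * c) (a' * b' * c') d d']

/-- The exponents are linear in the jump; nonnegativity ensures that `toNat` truncates nothing. -/
theorem Weights.ofJump_add {R : Type*} [CommMonoid R] (w : Weights R) {j k : Jump}
    (hj : j.Nonneg) (hk : k.Nonneg) : w.ofJump (j.add k) = w.ofJump j * w.ofJump k := by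
  have e1 := Int.toNat_add hj.bs hk.bs
  have e2 := Int.toNat_add hj.bp hk.bp
  have e3 := Int.toNat_add hj.olc hk.olc
  have e4 := Int.toNat_add hj.olh hk.olh
  have e2' : j.size + k.size - (j.bdry + k.bdry) - 2 * (j.vert + k.vert) =
    (j.size - j.bdry - 2 * j.vert) + (k.size - k.bdry - 2 * k.vert) := by ring
  have e4' : j.size + k.size + (j.bdry + k.bdry) - 2 * (j.dual + k.dual) =
    (j.size + j.bdry - 2 * j.dual) + (k.size + k.bdry - 2 * k.dual) := by ring
  simp only [ofJump, Jump.add]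
  rw [e2', e4', e1, e2, e3, e4, pow_add, pow_add, pow_add, pow_add]
  exact mul_four_mul_comm _ _ _ _ _ _ _ _

theorem Weights.ofJump_zero {R : Type*} [CommMonoid R] (w : Weights R) :
    w.ofJump ⟨0, 0, 0, 0⟩ = 1 := by
  simp [ofJump]

open Classical in
/-- The jump of a single edge, in terms of the relations that determine its kind. -/
noncomputable def edgeJump {F : Type} (s v t b : Setoid F) (e : Finset F) : Jump where
  size := 1
  vert := if OneClass v e then 0 else 1
  bdry := (if OneClass t e then 0 else 1) - (if OneClass s e then 0 else 1)
  dual := if OneClass b e then 0 else 1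

/-- If `e` separates vertex colours, it joins two classes of `s`, and `h` then forces `bdry = -1`,
so that `size - bdry - 2 * vert = 0`. Dually, separated boundary colours force `bdry = 1`. Without
`h`, an exponent could be `-1`. -/
theorem edgeJump_nonneg {F : Type} {s v t b : Setoid F} {e : Finset F}
    (h : OneClass t e ∨ OneClass s e) (hsv : s ≤ v) (htb : t ≤ b) :
    (edgeJump s v t b e).Nonneg := by
  have h1 : OneClass s e → OneClass v e := OneClass.mono hsv
  have h2 : OneClass t e → OneClass b e := OneClass.mono htb
  by_cases hs : OneClass s e <;> by_cases ht : OneClass t e <;> by_cases hv : OneClass v e <;>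
    by_cases hb : OneClass b e <;> first | tauto | (constructor <;> simp [edgeJump, *])

/-- The values of `bdry` are `-1` for `bs` and `bp`, `1` for `olc` and `olh`, and `0` for `nl`;
`vert` and `dual` tell the kinds apart within the two pairs. For `nl` both square roots get exponent
one, whence the choice of `a_nl` and `b_nl`. -/
theorem ofJump_edgeJump {F : Type} {s v t b : Setoid F} {e : Finset F}
    (h : OneClass t e ∨ OneClass s e) (hsv : s ≤ v) (htb : t ≤ b)
    {R : Type*} [CommMonoid R] (w : Weights R) {i : Kind} (hi : IsKind s v t b e i) :
    w.ofJump (edgeJump s v t b e) = w.ofKind i := by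
  have h1 : OneClass s e → OneClass v e := OneClass.mono hsv
  have h2 : OneClass t e → OneClass b e := OneClass.mono htb
  cases i <;> simp only [IsKind] at hi <;>
  by_cases hs : OneClass s e <;> by_cases ht : OneClass t e <;> by_cases hv : OneClass v e <;>
    by_cases hb : OneClass b e <;>
      first | tauto | simp [edgeJump, Weights.ofJump, Weights.ofKind, *]

end RibbonTutte

/-! ### Jumps between edge sets of a coloured ribbon graph, and spanning subgraphs of minors. -/

namespace RibbonTutte

open MvPolynomial

/-- The coefficients of deletions. -/
noncomputable def weightsA : Weights CoeffRing := ⟨X .aBs, X .sqrtABp, X .aOlc, X .sqrtAOlh⟩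

/-- The coefficients of contractions. -/
noncomputable def weightsB : Weights CoeffRing := ⟨X .bBs, X .sqrtBBp, X .bOlc, X .sqrtBOlh⟩

/-- The value of an edgeless graph with `n` vertex colour classes, `m` boundary colour classes and
`v` vertices. -/
noncomputable def edgelessValue (n m v : ℕ) : CoeffRing := X .alpha ^ n * X .beta ^ m * X .gamma ^ v

theorem weightsA_ofKind (i : Kind) : weightsA.ofKind i = coeffA i := by cases i <;> rfl

theorem weightsB_ofKind (i : Kind) : weightsB.ofKind i = coeffB i := by cases i <;> rfl

namespace RibbonGraph

variable (G : RibbonGraph)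

/-- The boundary involutions of `(V, A ∪ e)` and `(V, A)` differ only at the corners of `e`, where
the first is `τ₀` and the second `τ₂`, so the parity lemma applies. -/
theorem oneClass_subRel {A : Finset (Finset G.Flag)} {e : Finset G.Flag} (he : e ∈ G.edges)
    (heA : e ∉ A) :
    ColouredRibbonGraph.OneClass (G.subRel (insert e A)) e ∨
      ColouredRibbonGraph.OneClass (G.subRel A) e := by
  obtain ⟨x, hx, rfl⟩ := G.mem_edges.1 he
  rw [subRel_eq, subRel_eq]
  have hmem : ∀ y ∈ G.edgeOf x, G.edgeOf y = G.edgeOf x := fun y hy => G.edgeOf_eq_of_mem hy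
  have h0 : ∀ y ∈ G.edgeOf x, G.deleteτ₀ (G.edges \ insert (G.edgeOf x) A) y = G.τ₀ y :=
    fun y hy => by simp [deleteτ₀, hmem y hy]
  have h2 : ∀ y ∈ G.edgeOf x, G.deleteτ₀ (G.edges \ A) y = G.τ₂ y :=
    fun y hy => by simp [deleteτ₀, hmem y hy, he, heA]
  refine oneClass_or_oneClass_of_switch (x₀ := x) (x₁ := G.τ₀ x) (x₂ := G.τ₂ x)
    (x₃ := G.τ₀ (G.τ₂ x)) (G.delete _).τ₀_τ₀ (G.delete _).τ₀_ne G.τ₁_τ₁ G.τ₁_ne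
    (h0 _ (G.self_mem_edgeOf x)) (h0 _ (G.τ₂_mem_edgeOf x)) (h2 _ (G.self_mem_edgeOf x))
    ((h2 _ (G.τ₀_mem_edgeOf x)).trans (G.τ₀_τ₂ x).symm) (G.τ₀_ne x) (G.τ₂_ne x) ?_ ?_
  · intro h
    apply hx
    rw [← G.τ₀_τ₀ (G.τ₂ x), h]
  · intro y hy
    have hyx : G.edgeOf y ≠ G.edgeOf x := fun h => by
      have := G.self_mem_edgeOf y
      rw [h] at this
      exact hy this
    simp [deleteτ₀, hyx]

/-- A common coarsening through which the boundary counts of `A ∪ e` and `A` are compared. -/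
theorem subRel_insert_sup {A : Finset (Finset G.Flag)} {e : Finset G.Flag} (he : e ∈ G.edges) :
    G.subRel (insert e A) ⊔ joinRel {e} = G.subRel A ⊔ joinRel {e} := by
  have hagree : ∀ y, y ∉ e → G.deleteτ₀ (G.edges \ insert e A) y = G.deleteτ₀ (G.edges \ A) y := by
    intro y hy
    have hye : G.edgeOf y ≠ e := fun h => hy (h ▸ G.self_mem_edgeOf y)
    simp [deleteτ₀, hye]
  have hstable : ∀ B, ∀ y ∈ e, G.deleteτ₀ B y ∈ e := by
    intro B y hy
    rw [deleteτ₀, ← G.edgeOf_eq_of_mem_edges he hy]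
    split_ifs
    · exact G.τ₂_mem_edgeOf y
    · exact G.τ₀_mem_edgeOf y
  rw [subRel_eq, subRel_eq]
  exact le_antisymm (orbitRel_sup_joinRel_le (hstable _) hagree)
    (orbitRel_sup_joinRel_le (hstable _) fun y hy => (hagree y hy).symm)

open Classical in
/-- An edge meets at most two classes of a relation that contains one of the pairings of its
corners. -/
theorem numClasses_eq_add_of_edge {e : Finset G.Flag} (he : e ∈ G.edges) {s : Setoid G.Flag}
    (hs : (∀ x ∈ e, s x (G.τ₀ x)) ∨ ∀ x ∈ e, s x (G.τ₂ x)) :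
    numClasses s =
      numClasses (s ⊔ joinRel {e}) + if ColouredRibbonGraph.OneClass s e then 0 else 1 := by
  obtain ⟨x, hx, rfl⟩ := G.mem_edges.1 he
  rcases hs with hs | hs
  · refine numClasses_eq_sup_joinRel_add s (G.self_mem_edgeOf x) (G.τ₂_mem_edgeOf x) ?_
    intro z hz
    simp only [edgeOf, Finset.mem_insert, Finset.mem_singleton] at hz
    rcases hz with rfl | rfl | rfl | rfl
    · exact Or.inl (s.refl' _)
    · exact Or.inl (s.symm' (hs _ (G.self_mem_edgeOf x)))
    · exact Or.inr (s.refl' _)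
    · exact Or.inr (s.symm' (hs _ (G.τ₂_mem_edgeOf x)))
  · refine numClasses_eq_sup_joinRel_add s (G.self_mem_edgeOf x) (G.τ₀_mem_edgeOf x) ?_
    intro z hz
    simp only [edgeOf, Finset.mem_insert, Finset.mem_singleton] at hz
    rcases hz with rfl | rfl | rfl | rfl
    · exact Or.inl (s.refl' _)
    · exact Or.inr (s.refl' _)
    · exact Or.inl (s.symm' (hs _ (G.self_mem_edgeOf x)))
    · rw [G.τ₀_τ₂]
      exact Or.inr (s.symm' (hs _ (G.τ₀_mem_edgeOf x)))

open Classical in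
theorem numClasses_subRel {B : Finset (Finset G.Flag)} {e : Finset G.Flag} (he : e ∈ G.edges) :
    numClasses (G.subRel B) = numClasses (G.subRel B ⊔ joinRel {e}) +
      if ColouredRibbonGraph.OneClass (G.subRel B) e then 0 else 1 := by
  apply G.numClasses_eq_add_of_edge he
  have h : ∀ x, G.subRel B x (G.deleteτ₀ (G.edges \ B) x) := fun x => orbitRel_left _ _ x
  by_cases hB : e ∈ G.edges \ B
  · refine Or.inr fun x hx => ?_
    have := h x
    rwa [deleteτ₀, G.edgeOf_eq_of_mem_edges he hx, if_pos hB] at this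
  · refine Or.inl fun x hx => ?_
    have := h x
    rwa [deleteτ₀, G.edgeOf_eq_of_mem_edges he hx, if_neg hB] at this

theorem delete_subRel {A : Finset (Finset G.Flag)} {e : Finset G.Flag} (he : e ∈ G.edges)
    (heA : e ∉ A) : @Eq (Setoid G.Flag) ((G.delete {e}).subRel A) (G.subRel A) := by
  have : {e} ∪ ((G.edges \ {e}) \ A) = G.edges \ A := by
    ext e'
    by_cases h : e' = e
    · subst h; simp [he, heA]
    · simp [h]
  have h := G.delete_deleteτ₀ {e} (G.deleteEdges {e} \ A)
  rw [deleteEdges_eq, this, ← deleteEdges_eq] at h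
  exact congrArg (fun f => orbitRel f G.τ₁) h

theorem contract_subRel {A : Finset (Finset G.Flag)} {e : Finset G.Flag} :
    @Eq (Setoid G.Flag) ((G.contract {e}).subRel A) (G.subRel (insert e A)) := by
  have : (G.edges \ {e}) \ A = G.edges \ insert e A := by
    ext e'; simp [and_assoc]
  have h := G.contract_deleteτ₀ (A := {e}) (B := G.contractEdges {e} \ A)
    (by rw [contractEdges_eq, this]; exact Finset.sdiff_subset)
    (by rw [contractEdges_eq, this]; simp)
  rw [contractEdges_eq, this] at h
  rw [subRel_eq, ← h, ← this, ← contractEdges_eq]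
  rfl

end RibbonGraph

namespace ColouredRibbonGraph

variable (G : ColouredRibbonGraph)

/-- The number of components of the spanning subgraph of `G/𝒱` with edge set `A`. -/
noncomputable def vertCount (A : Finset (Finset G.Flag)) : ℕ := graphComponents G.vcol A

/-- The number of components of the spanning subgraph of `G*/ℬ` with edge set `Aᶜ`. -/
noncomputable def dualCount (A : Finset (Finset G.Flag)) : ℕ :=
  graphComponents G.bcol (G.edges \ A)

/-- The jump between two sets of edges. -/
noncomputable def jump (A B : Finset (Finset G.Flag)) : Jump where
  size := B.card - A.card
  vert := G.vertCount A - G.vertCount B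
  bdry := G.subBoundary B - G.subBoundary A
  dual := G.dualCount B - G.dualCount A

theorem jump_add (A B D : Finset (Finset G.Flag)) :
    (G.jump A B).add (G.jump B D) = G.jump A D := by
  simp only [Jump.add, jump, Jump.mk.injEq]
  refine ⟨?_, ?_, ?_, ?_⟩ <;> ring

theorem jump_self (A : Finset (Finset G.Flag)) : G.jump A A = ⟨0, 0, 0, 0⟩ := by
  simp [jump]

/-- Boundary components of `(V, A)` are vertices of `G/A`, and the right-hand side is the vertex
colouring of `G/A`. -/
theorem subRel_le_vcol (A : Finset (Finset G.Flag)) : G.subRel A ≤ G.vcol ⊔ joinRel A :=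
  G.contract_vertexRel A ▸ (G.contract A).vertexRel_le

theorem subRel_le_bcol (A : Finset (Finset G.Flag)) :
    G.subRel A ≤ G.bcol ⊔ joinRel (G.edges \ A) :=
  (G.delete (G.edges \ A)).boundaryRel_le

/-- The jump of adding the edge `e` to `A`, in terms of classes. -/
noncomputable def insertJump (A : Finset (Finset G.Flag)) (e : Finset G.Flag) : Jump :=
  edgeJump (G.subRel A) (G.vcol ⊔ joinRel A) (G.subRel (insert e A))
    (G.bcol ⊔ joinRel (G.edges \ insert e A)) e

theorem jump_insert {A : Finset (Finset G.Flag)} {e : Finset G.Flag} (he : e ∈ G.edges)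
    (heA : e ∉ A) : G.jump A (insert e A) = G.insertJump A e := by
  classical
  have hv : G.vertCount A = G.vertCount (insert e A) +
      if OneClass (G.vcol ⊔ joinRel A) e then 0 else 1 := by
    have := G.numClasses_eq_add_of_edge he (s := G.vcol ⊔ joinRel A) (Or.inr fun x _ =>
      (le_sup_left : G.vcol ≤ G.vcol ⊔ joinRel A) (G.vertexRel_le (orbitRel_right _ _ x)))
    rwa [sup_assoc, ← joinRel_union, Finset.union_comm, ← Finset.insert_eq] at this
  -- The dual graph carries the complementary edges: enlarging `A` by `e` removes `e` there, so the
  -- merging starts from `A ∪ e`.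
  have hb : G.dualCount (insert e A) = G.dualCount A +
      if OneClass (G.bcol ⊔ joinRel (G.edges \ insert e A)) e then 0 else 1 := by
    have := G.numClasses_eq_add_of_edge he (s := G.bcol ⊔ joinRel (G.edges \ insert e A))
      (Or.inl fun x _ => (le_sup_left : G.bcol ≤ G.bcol ⊔ joinRel (G.edges \ insert e A))
        (G.boundaryRel_le (orbitRel_left _ _ x)))
    have hE : (G.edges \ insert e A) ∪ {e} = G.edges \ A := by
      ext e'
      by_cases h : e' = e
      · subst h; simp [he, heA]
      · simp [h]
    rwa [sup_assoc, ← joinRel_union, hE] at this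
  have hs := G.numClasses_subRel (B := A) he
  have ht := G.numClasses_subRel (B := insert e A) he
  rw [G.subRel_insert_sup he] at ht
  change G.subBoundary A = _ at hs
  change G.subBoundary (insert e A) = _ at ht
  simp only [jump, insertJump, edgeJump, Jump.mk.injEq]
  rw [Finset.card_insert_of_notMem heA, hv, hb, hs, ht]
  refine ⟨?_, ?_, ?_, ?_⟩
  · push_cast; ring
  · split_ifs <;> push_cast <;> ring
  · split_ifs <;> push_cast <;> ring
  · split_ifs <;> push_cast <;> ring

theorem insertJump_nonneg {A : Finset (Finset G.Flag)} {e : Finset G.Flag} (he : e ∈ G.edges)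
    (heA : e ∉ A) : (G.insertJump A e).Nonneg :=
  edgeJump_nonneg (G.oneClass_subRel he heA) (G.subRel_le_vcol A) (G.subRel_le_bcol _)

/-- The jump telescopes into jumps of single edges. -/
theorem jump_nonneg {A B : Finset (Finset G.Flag)} (hAB : A ⊆ B) (hB : B ⊆ G.edges) :
    (G.jump A B).Nonneg := by
  suffices h : ∀ D : Finset (Finset G.Flag), D ⊆ G.edges → Disjoint A D →
      (G.jump A (A ∪ D)).Nonneg by
    have := h (B \ A) (Finset.sdiff_subset.trans hB) Finset.disjoint_sdiff
    rwa [Finset.union_sdiff_of_subset hAB] at this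
  intro D
  induction D using Finset.induction_on with
  | empty =>
    intro _ _
    rw [Finset.union_empty, jump_self]
    constructor <;> simp
  | insert e D he ih =>
    intro hD hAD
    rw [Finset.insert_subset_iff] at hD
    rw [Finset.disjoint_insert_right] at hAD
    have heA : e ∉ A ∪ D := by simp [he, hAD.1]
    rw [Finset.union_insert, ← G.jump_add A (A ∪ D), G.jump_insert hD.1 heA]
    exact (ih hD.2 hAD.2).add (G.insertJump_nonneg hD.1 heA)

/-! ## Edge types -/

theorem isOneEdge_iff (e : Finset G.Flag) (i : Kind) :
    G.IsOneEdge e i ↔ G.edges = {e} ∧ IsKind G.vertexRel G.vcol G.boundaryRel G.bcol e i := by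
  cases i <;> rfl

/-- The right-hand side is the data of the last step, from `E \ e` to `E`, in the form used by
`insertJump`. -/
theorem isOneEdge_contract_iff {e : Finset G.Flag} (he : e ∈ G.edges) (i : Kind) :
    (G.contract (G.edges.erase e)).IsOneEdge e i ↔
      IsKind (G.subRel (G.edges.erase e)) (G.vcol ⊔ joinRel (G.edges.erase e))
        (G.subRel (insert e (G.edges.erase e)))
        (G.bcol ⊔ joinRel (G.edges \ insert e (G.edges.erase e))) e i := by
  have h1 : G.contractEdges (G.edges.erase e) = {e} := by
    rw [G.contractEdges_eq]
    ext e'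
    by_cases h : e' = e
    · subst h; simp [he]
    · simp [h]
  rw [Finset.insert_erase he, G.subRel_edges, Finset.sdiff_self, joinRel_empty, sup_bot_eq,
    ← G.contract_vertexRel]
  exact ((G.contract (G.edges.erase e)).isOneEdge_iff e i).trans
    ⟨fun h => h.2, fun h => ⟨h1, h⟩⟩

/-- Here the data are those of the first step, from `∅` to `{e}`. -/
theorem isOneEdge_delete_iff {e : Finset G.Flag} (he : e ∈ G.edges) (i : Kind) :
    (G.delete (G.edges.erase e)).IsOneEdge e i ↔
      IsKind (G.subRel ∅) (G.vcol ⊔ joinRel ∅) (G.subRel (insert e ∅))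
        (G.bcol ⊔ joinRel (G.edges \ insert e ∅)) e i := by
  have h1 : G.deleteEdges (G.edges.erase e) = {e} := by
    rw [G.deleteEdges_eq]
    ext e'
    by_cases h : e' = e
    · subst h; simp [he]
    · simp [h]
  have h2 : G.edges \ insert e ∅ = G.edges.erase e := by
    rw [insert_empty_eq, Finset.sdiff_singleton_eq_erase]
  rw [G.subRel_empty, joinRel_empty, sup_bot_eq, RibbonGraph.subRel, h2]
  exact ((G.delete (G.edges.erase e)).isOneEdge_iff e i).trans
    ⟨fun h => h.2, fun h => ⟨h1, h⟩⟩

/-- Needed for uniqueness: the recursion constrains `U` only at edges that have a type. -/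
theorem exists_hasType {e : Finset G.Flag} (he : e ∈ G.edges) : ∃ i j, G.HasType e i j := by
  obtain ⟨i, hi⟩ := exists_isKind (G.subRel (G.edges.erase e)) (G.vcol ⊔ joinRel (G.edges.erase e))
    (G.subRel (insert e (G.edges.erase e)))
    (G.bcol ⊔ joinRel (G.edges \ insert e (G.edges.erase e))) e
  obtain ⟨j, hj⟩ := exists_isKind (G.subRel ∅) (G.vcol ⊔ joinRel ∅) (G.subRel (insert e ∅))
    (G.bcol ⊔ joinRel (G.edges \ insert e ∅)) e
  exact ⟨i, j, (G.isOneEdge_contract_iff he i).2 hi, (G.isOneEdge_delete_iff he j).2 hj⟩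

variable {G} in
theorem HasType.ofJump_left {e : Finset G.Flag} (he : e ∈ G.edges) {i j : Kind}
    (h : G.HasType e i j) :
    weightsA.ofJump (G.jump (G.edges.erase e) G.edges) = coeffA i := by
  have h1 := (G.isOneEdge_contract_iff he i).1 h.1
  have h2 := G.jump_insert he (Finset.notMem_erase e G.edges)
  rw [← weightsA_ofKind, ← ofJump_edgeJump
    (G.oneClass_subRel he (Finset.notMem_erase e G.edges)) (G.subRel_le_vcol _)
    (G.subRel_le_bcol _) weightsA h1]
  rw [insertJump] at h2
  rw [← h2, Finset.insert_erase he]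

variable {G} in
theorem HasType.ofJump_right {e : Finset G.Flag} (he : e ∈ G.edges) {i j : Kind}
    (h : G.HasType e i j) : weightsB.ofJump (G.jump ∅ {e}) = coeffB j := by
  have h1 := (G.isOneEdge_delete_iff he j).1 h.2
  have h2 := G.jump_insert he (Finset.notMem_empty e)
  rw [← weightsB_ofKind, ← ofJump_edgeJump
    (G.oneClass_subRel he (Finset.notMem_empty e)) (G.subRel_le_vcol _)
    (G.subRel_le_bcol _) weightsB h1]
  rw [insertJump] at h2
  rw [← h2, insert_empty_eq]

/-! ## The state sum -/

/-- The contribution of the edgeless graph that is left when the edges in `A` are contracted and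
all others are deleted. -/
noncomputable def stateBase (A : Finset (Finset G.Flag)) : CoeffRing :=
  edgelessValue (G.vertCount A) (G.dualCount A) (G.subBoundary A)

/-- The contribution of the set `A` of contracted edges to the state sum. -/
noncomputable def stateTerm (A : Finset (Finset G.Flag)) : CoeffRing :=
  G.stateBase A * weightsB.ofJump (G.jump ∅ A) * weightsA.ofJump (G.jump A G.edges)

/-- The state sum. -/
noncomputable def stateSum : CoeffRing := ∑ A ∈ G.edges.powerset, G.stateTerm A

variable {G} {A B : Finset (Finset G.Flag)} {e : Finset G.Flag}

/-- Deletion drops `e` from the complement of `A` but merges the boundary colours at `e`, which has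
the same effect. -/
theorem delete_dualCount (he : e ∈ G.edges) (heA : e ∉ A) :
    (G.delete {e}).dualCount A = G.dualCount A := by
  change numClasses ((G.bcol ⊔ joinRel {e}) ⊔ joinRel (G.deleteEdges {e} \ A)) = _
  have : {e} ∪ ((G.edges \ {e}) \ A) = G.edges \ A := by
    ext e'
    by_cases h : e' = e
    · subst h; simp [he, heA]
    · simp [h]
  rw [G.deleteEdges_eq, sup_assoc, ← joinRel_union, this]
  rfl

theorem delete_subBoundary (he : e ∈ G.edges) (heA : e ∉ A) :
    (G.delete {e}).subBoundary A = G.subBoundary A :=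
  congrArg numClasses (G.delete_subRel he heA)

theorem contract_vertCount : (G.contract {e}).vertCount A = G.vertCount (insert e A) := by
  change numClasses ((G.vcol ⊔ joinRel {e}) ⊔ joinRel A) = _
  rw [sup_assoc, ← joinRel_union, ← Finset.insert_eq]
  rfl

theorem contract_dualCount : (G.contract {e}).dualCount A = G.dualCount (insert e A) := by
  change numClasses (G.bcol ⊔ joinRel (G.contractEdges {e} \ A)) = _
  have : (G.edges \ {e}) \ A = G.edges \ insert e A := by
    ext e'; simp [and_assoc]
  rw [G.contractEdges_eq, this]
  rfl

theorem contract_subBoundary :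
    (G.contract {e}).subBoundary A = G.subBoundary (insert e A) :=
  congrArg numClasses (G.contract_subRel)

theorem delete_jump (he : e ∈ G.edges) (heA : e ∉ A) (heB : e ∉ B) :
    (G.delete {e}).jump A B = G.jump A B := by
  ext
  · rfl
  · rfl
  · exact congrArg₂ (fun m n : ℕ => (m : ℤ) - n) (delete_subBoundary he heB)
      (delete_subBoundary he heA)
  · exact congrArg₂ (fun m n : ℕ => (m : ℤ) - n) (delete_dualCount he heB)
      (delete_dualCount he heA)

theorem contract_jump (heA : e ∉ A) (heB : e ∉ B) :
    (G.contract {e}).jump A B = G.jump (insert e A) (insert e B) := by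
  ext
  · have : ((B.card : ℤ) - A.card) = (insert e B).card - (insert e A).card := by
      rw [Finset.card_insert_of_notMem heA, Finset.card_insert_of_notMem heB]
      push_cast
      ring
    exact this
  · exact congrArg₂ (fun m n : ℕ => (m : ℤ) - n) contract_vertCount contract_vertCount
  · exact congrArg₂ (fun m n : ℕ => (m : ℤ) - n) contract_subBoundary contract_subBoundary
  · exact congrArg₂ (fun m n : ℕ => (m : ℤ) - n) contract_dualCount contract_dualCount

theorem delete_stateBase (he : e ∈ G.edges) (heA : e ∉ A) :
    (G.delete {e}).stateBase A = G.stateBase A :=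
  congrArg₂ (edgelessValue (G.vertCount A)) (delete_dualCount he heA) (delete_subBoundary he heA)

theorem contract_stateBase : (G.contract {e}).stateBase A = G.stateBase (insert e A) := by
  have h : edgelessValue ((G.contract {e}).vertCount A) ((G.contract {e}).dualCount A)
      ((G.contract {e}).subBoundary A) = G.stateBase (insert e A) :=
    congr (congr (congrArg edgelessValue contract_vertCount) contract_dualCount)
      contract_subBoundary
  exact h

theorem delete_edges_singleton : G.deleteEdges {e} = G.edges.erase e := by
  rw [G.deleteEdges_eq, Finset.sdiff_singleton_eq_erase]

theorem contract_edges_singleton : G.contractEdges {e} = G.edges.erase e := by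
  rw [G.contractEdges_eq, Finset.sdiff_singleton_eq_erase]

/-- The terms of the state sum of `G.delete {e}`. -/
noncomputable def deleteTerm (G : ColouredRibbonGraph) (e : Finset G.Flag)
    (A : Finset (Finset G.Flag)) : CoeffRing := (G.delete {e}).stateTerm A

/-- The terms of the state sum of `G.contract {e}`. -/
noncomputable def contractTerm (G : ColouredRibbonGraph) (e : Finset G.Flag)
    (A : Finset (Finset G.Flag)) : CoeffRing := (G.contract {e}).stateTerm A

theorem deleteTerm_eq (he : e ∈ G.edges) (heA : e ∉ A) :
    G.deleteTerm e A = G.stateBase A * weightsB.ofJump (G.jump ∅ A) *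
      weightsA.ofJump (G.jump A (G.edges.erase e)) := by
  have h : G.deleteTerm e A = (G.delete {e}).stateBase A *
    weightsB.ofJump ((G.delete {e}).jump (∅ : Finset (Finset G.Flag)) A) *
    weightsA.ofJump ((G.delete {e}).jump A (G.deleteEdges {e})) := rfl
  rw [h, delete_edges_singleton, delete_stateBase he heA,
    delete_jump he (Finset.notMem_empty e) heA, delete_jump he heA (Finset.notMem_erase e _)]

theorem contractTerm_eq (he : e ∈ G.edges) (heA : e ∉ A) :
    G.contractTerm e A = G.stateBase (insert e A) *
      weightsB.ofJump (G.jump {e} (insert e A)) *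
      weightsA.ofJump (G.jump (insert e A) G.edges) := by
  have h : G.contractTerm e A = (G.contract {e}).stateBase A *
    weightsB.ofJump ((G.contract {e}).jump (∅ : Finset (Finset G.Flag)) A) *
    weightsA.ofJump ((G.contract {e}).jump A (G.contractEdges {e})) := rfl
  rw [h, contract_edges_singleton, contract_stateBase,
    contract_jump (Finset.notMem_empty e) heA, contract_jump heA (Finset.notMem_erase e _),
    Finset.insert_erase he, insert_empty_eq]

/-- The jump from `A` to `E` is split at `E \ e`; its last piece contributes `a_i`. -/
theorem HasType.stateTerm_of_notMem (he : e ∈ G.edges) {i j : Kind} (h : G.HasType e i j)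
    (hA : A ⊆ G.edges.erase e) : G.stateTerm A = coeffA i * G.deleteTerm e A := by
  have heA : e ∉ A := fun h => Finset.notMem_erase e _ (hA h)
  rw [deleteTerm_eq he heA, stateTerm, ← G.jump_add A (G.edges.erase e) G.edges,
    Weights.ofJump_add _ (G.jump_nonneg hA (Finset.erase_subset _ _))
      (G.jump_nonneg (Finset.erase_subset _ _) subset_rfl), h.ofJump_left he]
  ring

/-- The jump from `∅` to `A ∪ e` is split at `{e}`; its first piece contributes `b_j`. -/
theorem HasType.stateTerm_insert (he : e ∈ G.edges) {i j : Kind} (h : G.HasType e i j)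
    (hA : A ⊆ G.edges.erase e) : G.stateTerm (insert e A) = coeffB j * G.contractTerm e A := by
  have heA : e ∉ A := fun h => Finset.notMem_erase e _ (hA h)
  have hA' : insert e A ⊆ G.edges :=
    Finset.insert_subset he (hA.trans (Finset.erase_subset _ _))
  rw [contractTerm_eq he heA, stateTerm, ← G.jump_add ∅ {e} (insert e A),
    Weights.ofJump_add _ (G.jump_nonneg (Finset.empty_subset _) (Finset.singleton_subset_iff.2 he))
      (G.jump_nonneg (Finset.singleton_subset_iff.2 (Finset.mem_insert_self e A)) hA'),
    h.ofJump_right he]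
  ring

theorem delete_stateSum :
    (G.delete {e}).stateSum = ∑ A ∈ (G.edges.erase e).powerset, G.deleteTerm e A := by
  rw [← delete_edges_singleton]
  rfl

theorem contract_stateSum :
    (G.contract {e}).stateSum = ∑ A ∈ (G.edges.erase e).powerset, G.contractTerm e A := by
  rw [← contract_edges_singleton]
  rfl

theorem HasType.stateSum_eq (he : e ∈ G.edges) {i j : Kind} (h : G.HasType e i j) :
    G.stateSum = coeffA i * (G.delete {e}).stateSum + coeffB j * (G.contract {e}).stateSum := by
  rw [delete_stateSum, contract_stateSum, Finset.mul_sum, Finset.mul_sum, stateSum]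
  conv_lhs => rw [← Finset.insert_erase he]
  rw [Finset.sum_powerset_insert (Finset.notMem_erase e _)]
  exact congrArg₂ (fun p q => p + q)
    (Finset.sum_congr rfl fun A hA => h.stateTerm_of_notMem he (Finset.mem_powerset.1 hA))
    (Finset.sum_congr rfl fun A hA => h.stateTerm_insert he (Finset.mem_powerset.1 hA))

theorem stateSum_of_edges_eq_empty (h : G.edges = ∅) :
    G.stateSum = edgelessValue (numClasses G.vcol) (numClasses G.bcol) G.numVertices := by
  rw [stateSum, h, Finset.powerset_empty, Finset.sum_singleton, stateTerm, h, G.jump_self,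
    Weights.ofJump_zero, Weights.ofJump_zero, mul_one, mul_one, stateBase, vertCount, dualCount,
    G.subBoundary_empty, h, Finset.sdiff_self, graphComponents, graphComponents, joinRel_empty,
    sup_bot_eq, sup_bot_eq]

end ColouredRibbonGraph

theorem stateSum_satisfiesRecursion {C : Set ColouredRibbonGraph} (hC : MinorClosed C) :
    SatisfiesRecursion hC fun G => G.1.stateSum where
  edge _ _ he _ _ h := h.stateSum_eq he
  edgeless _ h := ColouredRibbonGraph.stateSum_of_edges_eq_empty h

theorem SatisfiesRecursion.eq_stateSum {C : Set ColouredRibbonGraph} {hC : MinorClosed C}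
    {U : C → CoeffRing} (hU : SatisfiesRecursion hC U) (G : C) : U G = G.1.stateSum := by
  induction hn : G.1.edges.card generalizing G with
  | zero =>
    have h := Finset.card_eq_zero.1 hn
    rw [hU.edgeless G h, ColouredRibbonGraph.stateSum_of_edges_eq_empty h, edgelessValue]
  | succ n ih =>
    obtain ⟨e, he⟩ : G.1.edges.Nonempty := by
      rw [← Finset.card_pos]
      omega
    obtain ⟨i, j, h⟩ := G.1.exists_hasType he
    have hcard : (G.1.edges.erase e).card = n := by
      rw [Finset.card_erase_of_mem he, hn, Nat.add_sub_cancel]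
    rw [hU.edge G e he i j h, h.stateSum_eq he, ih, ih]
    · exact (congrArg Finset.card ColouredRibbonGraph.contract_edges_singleton).trans hcard
    · exact (congrArg Finset.card ColouredRibbonGraph.delete_edges_singleton).trans hcard

end RibbonTutte

/-! ### Comparison of the state sum with `T_ps`. -/

namespace RibbonTutte

open MvPolynomial

theorem zpow_split_eq {K : Type*} [Field K] {x : K} (hx : x ≠ 0) {l m n : ℤ} (h : l = m + n) :
    x ^ l = x ^ m * x ^ n := by
  rw [h, zpow_add₀ hx]

theorem zpow_split_div_eq {K : Type*} [Field K] {x : K} (hx : x ≠ 0) {l m n : ℤ}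
    (h : l = m - n) : x ^ l = x ^ m / x ^ n := by
  rw [h, zpow_sub₀ hx]

/-- The comparison of a term of the state sum with a term of the universality formula. -/
theorem monomial_identity {K : Type*} [Field K] {α β g aBs aBp aOlc aOlh bBs bBp bOlc bOlh : K}
    (hα : α ≠ 0) (hβ : β ≠ 0) (hg : g ≠ 0) (haOlc : aOlc ≠ 0) (haOlh : aOlh ≠ 0)
    (hbBs : bBs ≠ 0) (hbBp : bBp ≠ 0) (vE vA v0 dE dA d0 bE bA b0 nE nA : ℤ) :
    α ^ vA * β ^ dA * (g ^ 2) ^ bA *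
        (bBs ^ (v0 - vA) * bBp ^ (nA - (bA - b0) - 2 * (v0 - vA)) * bOlc ^ (dA - d0) *
          bOlh ^ (nA + (bA - b0) - 2 * (dA - d0))) *
        (aBs ^ (vA - vE) * aBp ^ (nE - nA - (bE - bA) - 2 * (vA - vE)) * aOlc ^ (dE - dA) *
          aOlh ^ (nE - nA + (bE - bA) - 2 * (dE - dA))) =
      α ^ vE * β ^ d0 * g ^ (2 * b0 - (b0 + nE - bE)) * bBs ^ (v0 - vE) *
        bBp ^ (b0 + nE - bE - 2 * (v0 - vE)) * aOlc ^ (dE - d0) *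
        aOlh ^ (2 * (nE - (dE - d0)) - (b0 + nE - bE)) *
        ((α * g ^ 2 * aBs / bBs) ^ (v0 - vE - (v0 - vA)) *
          (g * aBp / bBp) ^ (b0 + nE - bE - 2 * (v0 - vE) - (b0 + nA - bA - 2 * (v0 - vA))) *
          (β * g ^ 2 * bOlc / aOlc) ^ (dA - d0) *
          (g * bOlh / aOlh) ^ (2 * (nA - (dA - d0)) - (b0 + nA - bA))) := by
  -- The letters `v`, `d`, `b`, `n` stand for `vertCount`, `dualCount`, `subBoundary` and the number
  -- of edges, at `E`, `A` and `∅`; `g ^ 2` is `γ`, and `b0 + nA - bA` is `2ρ(A)`.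
  have e1 : v0 - vE - (v0 - vA) = vA - vE := by ring
  have e2 : b0 + nE - bE - 2 * (v0 - vE) - (b0 + nA - bA - 2 * (v0 - vA)) =
    nE - nA - (bE - bA) - 2 * (vA - vE) := by ring
  have e3 : 2 * (nA - (dA - d0)) - (b0 + nA - bA) = nA + (bA - b0) - 2 * (dA - d0) := by ring
  rw [e1, e2, e3]
  simp only [div_zpow, mul_zpow]
  have f1 : α ^ vA = α ^ vE * α ^ (vA - vE) := zpow_split_eq hα (by ring)
  have f2 : β ^ dA = β ^ d0 * β ^ (dA - d0) := zpow_split_eq hβ (by ring)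
  -- The prefactor `γ^(v - ρ)` and the factors `γ` in the four arguments of `T_ps` combine to
  -- `γ^b(A)`.
  have f3 : (g ^ 2) ^ bA = g ^ (2 * b0 - (b0 + nE - bE)) * (g ^ 2) ^ (vA - vE) *
      g ^ (nE - nA - (bE - bA) - 2 * (vA - vE)) * (g ^ 2) ^ (dA - d0) *
      g ^ (nA + (bA - b0) - 2 * (dA - d0)) := by
    have : ∀ n : ℤ, (g ^ 2) ^ n = g ^ (2 * n) := fun n => by
      rw [zpow_mul, zpow_ofNat]
    rw [this, this, this, ← zpow_add₀ hg, ← zpow_add₀ hg, ← zpow_add₀ hg, ← zpow_add₀ hg]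
    congr 1
    ring
  have f4 : bBs ^ (v0 - vA) = bBs ^ (v0 - vE) / bBs ^ (vA - vE) :=
    zpow_split_div_eq hbBs (by ring)
  have f5 : bBp ^ (nA - (bA - b0) - 2 * (v0 - vA)) = bBp ^ (b0 + nE - bE - 2 * (v0 - vE)) /
      bBp ^ (nE - nA - (bE - bA) - 2 * (vA - vE)) := zpow_split_div_eq hbBp (by ring)
  have f6 : aOlc ^ (dE - dA) = aOlc ^ (dE - d0) / aOlc ^ (dA - d0) :=
    zpow_split_div_eq haOlc (by ring)
  have f7 : aOlh ^ (nE - nA + (bE - bA) - 2 * (dE - dA)) =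
      aOlh ^ (2 * (nE - (dE - d0)) - (b0 + nE - bE)) / aOlh ^ (nA + (bA - b0) - 2 * (dA - d0)) :=
    zpow_split_div_eq haOlh (by ring)
  rw [f1, f2, f3, f4, f5, f6, f7]
  ring

theorem pow_toNat_eq_zpow {K : Type*} [Field K] (x : K) {n : ℤ} (hn : 0 ≤ n) :
    x ^ n.toNat = x ^ n := by
  conv_rhs => rw [← Int.toNat_of_nonneg hn, zpow_natCast]

theorem map_ofJump {K : Type*} [Field K] (φ : CoeffRing →+* K) (w : Weights CoeffRing) {j : Jump}
    (hj : j.Nonneg) :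
    φ (w.ofJump j) = φ w.bs ^ j.vert * φ w.sqrtBp ^ (j.size - j.bdry - 2 * j.vert) *
      φ w.olc ^ j.dual * φ w.sqrtOlh ^ (j.size + j.bdry - 2 * j.dual) := by
  simp only [Weights.ofJump, map_mul, map_pow, pow_toNat_eq_zpow _ hj.bs,
    pow_toNat_eq_zpow _ hj.bp, pow_toNat_eq_zpow _ hj.olc, pow_toNat_eq_zpow _ hj.olh]

namespace ColouredRibbonGraph

variable (G : ColouredRibbonGraph)

theorem r₁_eq (A : Finset (Finset G.Flag)) :
    G.r₁ A = (G.vertCount ∅ : ℤ) - G.vertCount A := by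
  rw [r₁, graphRank, vertCount, vertCount, graphComponents, graphComponents, joinRel_empty,
    sup_bot_eq]

theorem r₃_eq (A : Finset (Finset G.Flag)) :
    G.r₃ A = (G.dualCount A : ℤ) - G.dualCount ∅ := by
  rw [r₃, graphRank, graphRank, dualCount, dualCount, Finset.sdiff_empty]
  ring

theorem twoR₂_eq (A : Finset (Finset G.Flag)) :
    G.twoR₂ A = (G.subBoundary ∅ : ℤ) + A.card - G.subBoundary A -
      2 * ((G.vertCount ∅ : ℤ) - G.vertCount A) := by
  rw [twoR₂, r₁_eq, G.twoRho_eq]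

theorem twoR₄_eq (A : Finset (Finset G.Flag)) :
    G.twoR₄ A = 2 * ((A.card : ℤ) - ((G.dualCount A : ℤ) - G.dualCount ∅)) -
      ((G.subBoundary ∅ : ℤ) + A.card - G.subBoundary A) := by
  rw [← G.twoRho_eq, ← r₃_eq, r₃, twoR₄]
  ring

theorem map_stateSum (K : Type*) [Field K] [Algebra CoeffRing K]
    (hK : Function.Injective (algebraMap CoeffRing K)) (g : K)
    (hg : g ^ 2 = algebraMap CoeffRing K (X Var.gamma)) :
    algebraMap CoeffRing K G.stateSum = G.universalValue K g := by
  have hne : ∀ t : Var, algebraMap CoeffRing K (X t) ≠ 0 := fun t h =>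
    X_ne_zero t (hK (h.trans (map_zero _).symm))
  have hg0 : g ≠ 0 := by
    rintro rfl
    exact hne .gamma (by rw [← hg, zero_pow two_ne_zero])
  have hd : graphComponents G.bcol G.edges = G.dualCount ∅ := by
    rw [dualCount, Finset.sdiff_empty]
  rw [stateSum, map_sum, universalValue, Tps, Finset.mul_sum]
  refine Finset.sum_congr rfl fun A hA => ?_
  rw [Finset.mem_powerset] at hA
  have h := monomial_identity (aBs := algebraMap CoeffRing K (X .aBs))
    (aBp := algebraMap CoeffRing K (X .sqrtABp)) (bOlc := algebraMap CoeffRing K (X .bOlc))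
    (bOlh := algebraMap CoeffRing K (X .sqrtBOlh)) (hne .alpha) (hne .beta) hg0 (hne .aOlc)
    (hne .sqrtAOlh) (hne .bBs) (hne .sqrtBBp) (G.vertCount G.edges) (G.vertCount A)
    (G.vertCount ∅) (G.dualCount G.edges) (G.dualCount A) (G.dualCount ∅)
    (G.subBoundary G.edges) (G.subBoundary A) (G.subBoundary ∅) G.edges.card A.card
  rw [stateTerm, stateBase, edgelessValue, map_mul, map_mul,
    map_ofJump _ _ (G.jump_nonneg (Finset.empty_subset A) hA),
    map_ofJump _ _ (G.jump_nonneg hA subset_rfl)]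
  simp only [weightsA, weightsB, jump, Finset.card_empty, Nat.cast_zero, sub_zero, map_mul,
    map_pow, r₁_eq, r₃_eq, twoR₂_eq, twoR₄_eq, G.twoRho_eq, ← G.subBoundary_empty, hd, ← hg]
  simp only [zpow_natCast] at h
  exact h

end ColouredRibbonGraph

end RibbonTutte

/-! ### Invariance of the state sum under equivalence. -/

namespace RibbonTutte

/-- Involutions that preserve `W` preserve its complement too, so membership in `W` is constant on
orbits. -/
theorem mem_of_orbitRel {F : Type} {f g : F → F} (hf : ∀ x, f (f x) = x) (hg : ∀ x, g (g x) = x)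
    {W : Set F} (hWf : ∀ x ∈ W, f x ∈ W) (hWg : ∀ x ∈ W, g x ∈ W) {x y : F}
    (h : orbitRel f g x y) (hx : x ∈ W) : y ∈ W := by
  let s : Setoid F := Setoid.ker fun x => x ∈ W
  have hs : orbitRel f g ≤ s := orbitRel_le
    (fun x => propext ⟨hWf x, fun h => hf x ▸ hWf _ h⟩)
    (fun x => propext ⟨hWg x, fun h => hg x ▸ hWg _ h⟩)
  have hW : (x ∈ W) = (y ∈ W) := hs h
  rwa [hW] at hx

/-- The bijection `ψ` is one of classes, not of flags, since equivalent graphs may have different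
inert arcs. Chosen representatives give a map of flags along which the target relation is pulled
back. -/
theorem sup_joinRel_of_bijection {F F' : Type} {p : Setoid F} {q : Setoid F'}
    (ψ : Quotient p ≃ Quotient q) {c : Setoid F} {c' : Setoid F'} (hq : q ≤ c')
    (hc : ∀ x x' y y', ψ (Quotient.mk _ x) = Quotient.mk _ y →
      ψ (Quotient.mk _ x') = Quotient.mk _ y' → c x x' → c' y y')
    {A : Finset (Finset F)} {A' : Finset (Finset F')}
    (hA : ∀ e ∈ A, ∀ x ∈ e, ∀ x' ∈ e, ∃ y y', ψ (Quotient.mk _ x) = Quotient.mk _ y ∧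
      ψ (Quotient.mk _ x') = Quotient.mk _ y' ∧ joinRel A' y y')
    {x x' : F} {y y' : F'} (hxy : ψ (Quotient.mk _ x) = Quotient.mk _ y)
    (hxy' : ψ (Quotient.mk _ x') = Quotient.mk _ y') (h : (c ⊔ joinRel A) x x') :
    (c' ⊔ joinRel A') y y' := by
  set t := c' ⊔ joinRel A'
  let f : F → F' := fun x => (ψ (Quotient.mk _ x)).out
  have hf : ∀ x, ψ (Quotient.mk _ x) = Quotient.mk _ (f x) := fun x => (Quotient.out_eq _).symm
  have hqt : q ≤ t := hq.trans le_sup_left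
  have hft : ∀ {x y}, ψ (Quotient.mk _ x) = Quotient.mk _ y → t y (f x) := fun {x y} h =>
    hqt (Quotient.exact (h.symm.trans (hf x)))
  have hle : c ⊔ joinRel A ≤ t.comap f := by
    refine sup_le (fun a b hab => ?_) (joinRel_le fun e he a ha b hb => ?_)
    · exact (le_sup_left : c' ≤ t) (hc a b _ _ (hf a) (hf b) hab)
    · obtain ⟨u, v, hu, hv, huv⟩ := hA e he a ha b hb
      exact t.trans' (t.symm' (hft hu))
        (t.trans' ((le_sup_right : joinRel A' ≤ t) huv) (hft hv))
  exact t.trans' (hft hxy) (t.trans' (hle h) (t.symm' (hft hxy')))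

theorem numClasses_eq_of_bijection {F F' : Type} {p : Setoid F} {q : Setoid F'}
    (ψ : Quotient p ≃ Quotient q) {s : Setoid F} {t : Setoid F'}
    (h : ∀ x x' y y', ψ (Quotient.mk _ x) = Quotient.mk _ y →
      ψ (Quotient.mk _ x') = Quotient.mk _ y' → (s x x' ↔ t y y')) :
    numClasses s = numClasses t := by
  refine numClasses_eq_of_correspondence (fun x y => ψ (Quotient.mk _ x) = Quotient.mk _ y)
    (fun x => ⟨x, (ψ (Quotient.mk _ x)).out, s.refl' x, (Quotient.out_eq _).symm⟩)
    (fun y => ⟨y, (ψ.symm (Quotient.mk _ y)).out, t.refl' y, ?_⟩) h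
  rw [Quotient.out_eq, Equiv.apply_symm_apply]

namespace RibbonGraph

variable (G : RibbonGraph)

theorem deleteτ₀_of_not_onEdge {D : Finset (Finset G.Flag)} {x : G.Flag} (hx : ¬ G.OnEdge x) :
    G.deleteτ₀ D x = G.τ₂ x := by
  rw [deleteτ₀, G.τ₀_eq_τ₂ hx, ite_self]

/-- An arc uses only corner arcs and inert arcs, which lie on the boundary of every spanning
subgraph. -/
theorem subRel_of_arc (A : Finset (Finset G.Flag)) {x y : G.Flag} (h : G.Arc x y) :
    G.subRel A x y := by
  induction h with
  | base => exact orbitRel_right _ _ x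
  | step y _ hy ih =>
    have h1 : G.subRel A y (G.τ₂ y) := by
      rw [← G.deleteτ₀_of_not_onEdge (D := G.edges \ A) hy]
      exact orbitRel_left _ _ y
    exact (G.subRel A).trans' ih ((G.subRel A).trans' h1 (orbitRel_right _ _ _))

theorem Isolated.subRel_iff {G : RibbonGraph} {x : G.Flag} (hx : G.Isolated x)
    (A : Finset (Finset G.Flag)) (y : G.Flag) : G.subRel A x y ↔ G.vertexRel x y := by
  constructor
  · intro h
    refine mem_of_orbitRel (W := {y | G.vertexRel x y}) (G.delete (G.edges \ A)).τ₀_τ₀ G.τ₁_τ₁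
      (fun z hz => ?_) (fun z hz => G.vertexRel.trans' hz (orbitRel_left _ _ z)) h
      (G.vertexRel.refl' x)
    have : G.deleteτ₀ (G.edges \ A) z ∈ {y | G.vertexRel x y} := by
      rw [G.deleteτ₀_of_not_onEdge (hx z hz)]
      exact G.vertexRel.trans' hz (orbitRel_right _ _ z)
    exact this
  · intro h
    have : y ∈ {y | G.subRel A x y ∧ G.vertexRel x y} := by
      refine mem_of_orbitRel G.τ₁_τ₁ G.τ₂_τ₂ (fun z hz => ?_) (fun z hz => ?_) h
        ⟨(G.subRel A).refl' x, G.vertexRel.refl' x⟩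
      · exact ⟨(G.subRel A).trans' hz.1 (orbitRel_right _ _ z),
          G.vertexRel.trans' hz.2 (orbitRel_left _ _ z)⟩
      · refine ⟨(G.subRel A).trans' hz.1 ?_, G.vertexRel.trans' hz.2 (orbitRel_right _ _ z)⟩
        rw [← G.deleteτ₀_of_not_onEdge (D := G.edges \ A) (hx z hz.2)]
        exact orbitRel_left _ _ z
    exact this.1

/-- A boundary component that meets no edge disc runs along corner arcs and inert arcs only, so it
is a whole vertex circle. -/
theorem isolated_of_subRel {A : Finset (Finset G.Flag)} {x : G.Flag}
    (hx : ∀ y, G.subRel A x y → ¬ G.OnEdge y) : G.Isolated x := by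
  intro y hy
  refine hx y (mem_of_orbitRel (W := {y | G.subRel A x y}) G.τ₁_τ₁ G.τ₂_τ₂ (fun z hz => ?_)
    (fun z hz => ?_) hy ((G.subRel A).refl' x))
  · exact (G.subRel A).trans' hz (orbitRel_right _ _ z)
  · refine (G.subRel A).trans' hz ?_
    rw [← G.deleteτ₀_of_not_onEdge (D := G.edges \ A) (hx z hz)]
    exact orbitRel_left _ _ z

/-- A relation between the corners of edge discs that contains the pieces of vertex circles and the
action of `τ₀` in a spanning subgraph contains the relation of lying on a common boundary
component. -/
theorem of_subRel {A : Finset (Finset G.Flag)} (r : Setoid {x : G.Flag // G.OnEdge x})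
    (harc : ∀ x y : {x : G.Flag // G.OnEdge x}, G.Arc x.1 y.1 → r x y)
    (hτ : ∀ x y : {x : G.Flag // G.OnEdge x}, G.deleteτ₀ (G.edges \ A) x.1 = y.1 → r x y)
    {x y : {x : G.Flag // G.OnEdge x}} (h : G.subRel A x.1 y.1) : r x y := by
  -- All positions reached from a corner `u` related to `x`: the corner itself, the far end of a
  -- corner arc, or the far end of an inert arc. The third case makes `W` closed under both
  -- involutions.
  let W : Set G.Flag := {z | ∃ u, r x u ∧
    (z = u.1 ∨ G.Arc u.1 z ∨ ∃ w, G.Arc u.1 w ∧ ¬ G.OnEdge w ∧ z = G.τ₂ w)}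
  have hW1 : ∀ z ∈ W, G.τ₁ z ∈ W := by
    rintro z ⟨u, hu, rfl | hz | ⟨w, hw, hw', rfl⟩⟩
    · exact ⟨u, hu, Or.inr (Or.inl (Arc.base _))⟩
    · cases hz with
      | base => exact ⟨u, hu, Or.inl (G.τ₁_τ₁ _)⟩
      | step w hw hw' =>
        rw [G.τ₁_τ₁]
        exact ⟨u, hu, Or.inr (Or.inr ⟨w, hw, hw', rfl⟩)⟩
    · exact ⟨u, hu, Or.inr (Or.inl (Arc.step _ w hw hw'))⟩
  have hWedge : ∀ z (hz : G.OnEdge z), z ∈ W → r x ⟨z, hz⟩ := by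
    rintro z hz ⟨u, hu, rfl | h | ⟨w, hw, hw', rfl⟩⟩
    · exact hu
    · exact r.trans' hu (harc u ⟨z, hz⟩ h)
    · exact absurd (G.onEdge_τ₂.1 hz) hw'
  have hW0 : ∀ z ∈ W, G.deleteτ₀ (G.edges \ A) z ∈ W := by
    intro z hzW
    by_cases hz : G.OnEdge z
    · have hz' : G.OnEdge (G.deleteτ₀ (G.edges \ A) z) := by
        rw [deleteτ₀]
        split_ifs
        · exact G.onEdge_τ₂.2 hz
        · exact G.onEdge_τ₀.2 hz
      exact ⟨⟨_, hz'⟩, r.trans' (hWedge z hz hzW) (hτ ⟨z, hz⟩ ⟨_, hz'⟩ rfl), Or.inl rfl⟩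
    · rw [G.deleteτ₀_of_not_onEdge hz]
      obtain ⟨u, hu, rfl | h | ⟨w, hw, hw', rfl⟩⟩ := hzW
      · exact absurd u.2 hz
      · exact ⟨u, hu, Or.inr (Or.inr ⟨z, h, hz, rfl⟩)⟩
      · rw [G.τ₂_τ₂]
        exact ⟨u, hu, Or.inr (Or.inl hw)⟩
  exact hWedge y.1 y.2 (mem_of_orbitRel (G.delete (G.edges \ A)).τ₀_τ₀ G.τ₁_τ₁ hW0 hW1 h
    ⟨x, r.refl' x, Or.inl rfl⟩)

end RibbonGraph

namespace ColouredRibbonGraph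

variable {G H : ColouredRibbonGraph}

namespace Equivalence

theorem isolated_of_vertex_eq (φ : Equivalence G H) {x : G.Flag} {y : H.Flag} (hy : H.Isolated y)
    (h : φ.vertex (Quotient.mk _ x) = Quotient.mk _ y) : G.Isolated x := by
  intro z hz hze
  have h1 : (Quotient.mk G.vertexRel x) = Quotient.mk _ z := Quotient.sound hz
  rw [h1, φ.map_vertex ⟨z, hze⟩] at h
  exact hy _ (Quotient.exact h.symm) (φ.flag ⟨z, hze⟩).2

/-- The inverse of an equivalence. -/
def symm (φ : Equivalence G H) : Equivalence H G where
  flag := φ.flag.symm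
  vertex := φ.vertex.symm
  boundary := φ.boundary.symm
  map_τ₀ x y := by simpa using (φ.map_τ₀ (φ.flag.symm x) (φ.flag.symm y)).symm
  map_τ₂ x y := by simpa using (φ.map_τ₂ (φ.flag.symm x) (φ.flag.symm y)).symm
  map_arc x y := by simpa using (φ.map_arc (φ.flag.symm x) (φ.flag.symm y)).symm
  map_vertex x := by
    rw [Equiv.symm_apply_eq, φ.map_vertex, Equiv.apply_symm_apply]
  map_boundary x := by
    rw [Equiv.symm_apply_eq, φ.map_boundary, Equiv.apply_symm_apply]
  map_isolated y hy := by
    obtain ⟨x, hx⟩ := Quotient.exists_rep (φ.vertex.symm (Quotient.mk _ y))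
    have hxy : φ.vertex (Quotient.mk _ x) = Quotient.mk _ y := by
      rw [hx, Equiv.apply_symm_apply]
    have hxi := φ.isolated_of_vertex_eq hy hxy
    obtain ⟨y', hy', hv, hb⟩ := φ.map_isolated x hxi
    have hyy' : H.vertexRel y' y := Quotient.exact (hv.symm.trans hxy)
    -- The flag `y'` need not be `y`, but they share an isolated vertex, whose circle is a single
    -- boundary component.
    have hyy'b : H.boundaryRel y' y := by
      rw [← H.subRel_edges]
      exact (hy'.subRel_iff _ _).2 hyy'
    exact ⟨x, hxi, hx.symm, (Equiv.symm_apply_eq _).2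
      ((Quotient.sound hyy'b : Quotient.mk H.boundaryRel y' = _) ▸ hb.symm)⟩
  map_vcol x x' y y' h h' := by
    rw [Equiv.symm_apply_eq] at h h'
    exact (φ.map_vcol y y' x x' h.symm h'.symm).symm
  map_bcol x x' y y' h h' := by
    rw [Equiv.symm_apply_eq] at h h'
    exact (φ.map_bcol y y' x x' h.symm h'.symm).symm

variable (φ : Equivalence G H)

theorem flag_τ₀ (x : {x : G.Flag // G.OnEdge x}) :
    (φ.flag ⟨G.τ₀ x.1, G.onEdge_τ₀.2 x.2⟩).1 = H.τ₀ (φ.flag x).1 :=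
  ((φ.map_τ₀ x ⟨G.τ₀ x.1, G.onEdge_τ₀.2 x.2⟩).1 rfl).symm

theorem flag_τ₂ (x : {x : G.Flag // G.OnEdge x}) :
    (φ.flag ⟨G.τ₂ x.1, G.onEdge_τ₂.2 x.2⟩).1 = H.τ₂ (φ.flag x).1 :=
  ((φ.map_τ₂ x ⟨G.τ₂ x.1, G.onEdge_τ₂.2 x.2⟩).1 rfl).symm

theorem edgeOf_flag_eq {x y : {x : G.Flag // G.OnEdge x}} (h : G.edgeOf x.1 = G.edgeOf y.1) :
    H.edgeOf (φ.flag x).1 = H.edgeOf (φ.flag y).1 := by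
  have h1 := G.self_mem_edgeOf x.1
  rw [h] at h1
  simp only [RibbonGraph.edgeOf, Finset.mem_insert, Finset.mem_singleton] at h1
  rcases h1 with h1 | h1 | h1 | h1
  · rw [Subtype.ext h1]
  · have : x = ⟨G.τ₀ y.1, G.onEdge_τ₀.2 y.2⟩ := Subtype.ext h1
    rw [this, φ.flag_τ₀, H.edgeOf_τ₀]
  · have : x = ⟨G.τ₂ y.1, G.onEdge_τ₂.2 y.2⟩ := Subtype.ext h1
    rw [this, φ.flag_τ₂, H.edgeOf_τ₂]
  · have : x = ⟨G.τ₀ (G.τ₂ y.1), G.onEdge_τ₀.2 (G.onEdge_τ₂.2 y.2)⟩ := Subtype.ext h1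
    rw [this, φ.flag_τ₀ ⟨G.τ₂ y.1, G.onEdge_τ₂.2 y.2⟩, H.edgeOf_τ₀, φ.flag_τ₂, H.edgeOf_τ₂]

theorem edgeOf_flag_eq_iff {x y : {x : G.Flag // G.OnEdge x}} :
    H.edgeOf (φ.flag x).1 = H.edgeOf (φ.flag y).1 ↔ G.edgeOf x.1 = G.edgeOf y.1 :=
  ⟨fun h => by simpa [symm] using φ.symm.edgeOf_flag_eq h, φ.edgeOf_flag_eq⟩

/-- Two sets of edges correspond to each other under the equivalence. -/
structure Corresponds (A : Finset (Finset G.Flag)) (A' : Finset (Finset H.Flag)) : Prop where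
  subset_left : A ⊆ G.edges
  subset_right : A' ⊆ H.edges
  mem_iff : ∀ x : {x : G.Flag // G.OnEdge x}, G.edgeOf x.1 ∈ A ↔ H.edgeOf (φ.flag x).1 ∈ A'

variable {φ} {A B : Finset (Finset G.Flag)} {A' B' : Finset (Finset H.Flag)}

theorem Corresponds.symm (h : φ.Corresponds A A') : φ.symm.Corresponds A' A :=
  ⟨h.subset_right, h.subset_left, fun x => by
    have := h.mem_iff (φ.flag.symm x)
    rw [Equiv.apply_symm_apply] at this
    exact this.symm⟩

theorem Corresponds.compl (h : φ.Corresponds A A') :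
    φ.Corresponds (G.edges \ A) (H.edges \ A') :=
  ⟨Finset.sdiff_subset, Finset.sdiff_subset, fun x => by
    rw [Finset.mem_sdiff, Finset.mem_sdiff, h.mem_iff x]
    simp [G.edgeOf_mem_edges.2 x.2, H.edgeOf_mem_edges.2 (φ.flag x).2]⟩

theorem corresponds_edges (φ : Equivalence G H) : φ.Corresponds G.edges H.edges :=
  ⟨subset_rfl, subset_rfl, fun x => by
    simp [G.edgeOf_mem_edges.2 x.2, H.edgeOf_mem_edges.2 (φ.flag x).2]⟩

theorem corresponds_empty (φ : Equivalence G H) : φ.Corresponds ∅ ∅ :=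
  ⟨Finset.empty_subset _, Finset.empty_subset _, fun x => by simp⟩

theorem Corresponds.right_unique (h : φ.Corresponds A A') (h' : φ.Corresponds A B') :
    A' = B' := by
  have key : ∀ {C D : Finset (Finset H.Flag)}, φ.Corresponds A C → φ.Corresponds A D → C ⊆ D := by
    intro C D hC hD e he
    obtain ⟨y, hy, rfl⟩ := H.mem_edges.1 (hC.subset_right he)
    obtain ⟨x, hx⟩ := φ.flag.surjective ⟨y, hy⟩
    have hyx : y = (φ.flag x).1 := by rw [hx]
    rw [hyx] at he ⊢
    exact (hD.mem_iff x).1 ((hC.mem_iff x).2 he)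
  exact (key h h').antisymm (key h' h)

theorem Corresponds.card_le (h : φ.Corresponds A A') : A.card ≤ A'.card := by
  refine Finset.card_le_card_of_forall_subsingleton
    (fun e e' => ∃ x : {x : G.Flag // G.OnEdge x}, G.edgeOf x.1 = e ∧ H.edgeOf (φ.flag x).1 = e')
    (fun e he => ?_) (fun e' _ => ?_)
  · obtain ⟨x, hx, rfl⟩ := G.mem_edges.1 (h.subset_left he)
    exact ⟨_, (h.mem_iff ⟨x, hx⟩).1 he, ⟨x, hx⟩, rfl, rfl⟩
  · rintro e₁ ⟨-, x₁, rfl, h₁⟩ e₂ ⟨-, x₂, rfl, h₂⟩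
    exact φ.edgeOf_flag_eq_iff.1 (h₁.trans h₂.symm)

theorem Corresponds.card_eq (h : φ.Corresponds A A') : A.card = A'.card :=
  h.card_le.antisymm h.symm.card_le

theorem Corresponds.joinRel_flag (h : φ.Corresponds A A') {e : Finset G.Flag} (he : e ∈ A)
    {x x' : G.Flag} (hx : x ∈ e) (hx' : x' ∈ e) :
    ∃ (hxe : G.OnEdge x) (hxe' : G.OnEdge x'),
      joinRel A' (φ.flag ⟨x, hxe⟩).1 (φ.flag ⟨x', hxe'⟩).1 := by
  have h1 := G.edgeOf_eq_of_mem_edges (h.subset_left he) hx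
  have h2 := G.edgeOf_eq_of_mem_edges (h.subset_left he) hx'
  have hxe : G.OnEdge x := G.edgeOf_mem_edges.1 (h1 ▸ h.subset_left he)
  have hxe' : G.OnEdge x' := G.edgeOf_mem_edges.1 (h2 ▸ h.subset_left he)
  refine ⟨hxe, hxe', joinRel_rel ((h.mem_iff ⟨x, hxe⟩).1 (h1 ▸ he)) (H.self_mem_edgeOf _) ?_⟩
  rw [φ.edgeOf_flag_eq (x := ⟨x, hxe⟩) (y := ⟨x', hxe'⟩) (h1.trans h2.symm)]
  exact H.self_mem_edgeOf _

theorem Corresponds.sup_vcol (h : φ.Corresponds A A') {x x' : G.Flag} {y y' : H.Flag}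
    (hxy : φ.vertex (Quotient.mk _ x) = Quotient.mk _ y)
    (hxy' : φ.vertex (Quotient.mk _ x') = Quotient.mk _ y') (hx : (G.vcol ⊔ joinRel A) x x') :
    (H.vcol ⊔ joinRel A') y y' := by
  refine sup_joinRel_of_bijection φ.vertex H.vertexRel_le
    (fun x x' y y' h h' => (φ.map_vcol x x' y y' h h').1) ?_ hxy hxy' hx
  intro e he x hx x' hx'
  obtain ⟨h1, h2, h3⟩ := h.joinRel_flag he hx hx'
  exact ⟨_, _, φ.map_vertex ⟨x, h1⟩, φ.map_vertex ⟨x', h2⟩, h3⟩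

theorem Corresponds.sup_bcol (h : φ.Corresponds A A') {x x' : G.Flag} {y y' : H.Flag}
    (hxy : φ.boundary (Quotient.mk _ x) = Quotient.mk _ y)
    (hxy' : φ.boundary (Quotient.mk _ x') = Quotient.mk _ y') (hx : (G.bcol ⊔ joinRel A) x x') :
    (H.bcol ⊔ joinRel A') y y' := by
  refine sup_joinRel_of_bijection φ.boundary H.boundaryRel_le
    (fun x x' y y' h h' => (φ.map_bcol x x' y y' h h').1) ?_ hxy hxy' hx
  intro e he x hx x' hx'
  obtain ⟨h1, h2, h3⟩ := h.joinRel_flag he hx hx'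
  exact ⟨_, _, φ.map_boundary ⟨x, h1⟩, φ.map_boundary ⟨x', h2⟩, h3⟩

theorem Corresponds.vertCount_eq (h : φ.Corresponds A A') : G.vertCount A = H.vertCount A' :=
  numClasses_eq_of_bijection φ.vertex fun _ _ _ _ hxy hxy' =>
    ⟨h.sup_vcol hxy hxy', h.symm.sup_vcol ((Equiv.symm_apply_eq _).2 hxy.symm)
      ((Equiv.symm_apply_eq _).2 hxy'.symm)⟩

theorem Corresponds.dualCount_eq (h : φ.Corresponds A A') : G.dualCount A = H.dualCount A' :=
  numClasses_eq_of_bijection φ.boundary fun _ _ _ _ hxy hxy' =>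
    ⟨h.compl.sup_bcol hxy hxy', h.compl.symm.sup_bcol ((Equiv.symm_apply_eq _).2 hxy.symm)
      ((Equiv.symm_apply_eq _).2 hxy'.symm)⟩

theorem Corresponds.deleteτ₀_flag (h : φ.Corresponds A A') {x y : {x : G.Flag // G.OnEdge x}}
    (hxy : G.deleteτ₀ A x.1 = y.1) : H.deleteτ₀ A' (φ.flag x).1 = (φ.flag y).1 := by
  rw [RibbonGraph.deleteτ₀] at hxy ⊢
  by_cases hA : G.edgeOf x.1 ∈ A
  · rw [if_pos hA] at hxy
    rw [if_pos ((h.mem_iff x).1 hA)]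
    exact (φ.map_τ₂ x y).1 hxy
  · rw [if_neg hA] at hxy
    rw [if_neg fun h' => hA ((h.mem_iff x).2 h')]
    exact (φ.map_τ₀ x y).1 hxy

theorem Corresponds.subRel_flag (h : φ.Corresponds A A') {x y : {x : G.Flag // G.OnEdge x}}
    (hxy : G.subRel A x.1 y.1) : H.subRel A' (φ.flag x).1 (φ.flag y).1 :=
  G.of_subRel ((H.subRel A').comap fun x => (φ.flag x).1)
    (fun x y hxy => H.subRel_of_arc A' ((φ.map_arc x y).1 hxy))
    (fun x y hxy => by
      change H.subRel A' (φ.flag x).1 (φ.flag y).1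
      rw [← h.compl.deleteτ₀_flag hxy]
      exact orbitRel_left _ _ _) hxy

/-- Flags that lie on corresponding boundary components of spanning subgraphs, because they are
corresponding corners or belong to corresponding isolated vertices. -/
def FlagRel (φ : Equivalence G H) (x : G.Flag) (y : H.Flag) : Prop :=
  (∃ hx : G.OnEdge x, (φ.flag ⟨x, hx⟩).1 = y) ∨
    (G.Isolated x ∧ H.Isolated y ∧ φ.vertex (Quotient.mk _ x) = Quotient.mk _ y)

theorem FlagRel.symm {x : G.Flag} {y : H.Flag} (h : φ.FlagRel x y) : φ.symm.FlagRel y x := by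
  rcases h with ⟨hx, rfl⟩ | ⟨hx, hy, h⟩
  · exact Or.inl ⟨(φ.flag ⟨x, hx⟩).2, by simp [Equivalence.symm]⟩
  · exact Or.inr ⟨hy, hx, (Equiv.symm_apply_eq _).2 h.symm⟩

/-- Each boundary component of `(V, A)` contains a corner of an edge of `G` or is the circle of an
isolated vertex; an equivalence provides a partner in either case. -/
theorem exists_flagRel (φ : Equivalence G H) (A : Finset (Finset G.Flag)) (x : G.Flag) :
    ∃ x' y, G.subRel A x x' ∧ φ.FlagRel x' y := by
  by_cases hx : ∀ y, G.subRel A x y → ¬ G.OnEdge y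
  · have hxi := G.isolated_of_subRel hx
    obtain ⟨y, hy, hv, -⟩ := φ.map_isolated x hxi
    exact ⟨x, y, (G.subRel A).refl' x, Or.inr ⟨hxi, hy, hv⟩⟩
  · push Not at hx
    obtain ⟨x', hxx', hx'⟩ := hx
    exact ⟨x', _, hxx', Or.inl ⟨hx', rfl⟩⟩

theorem Corresponds.subRel_of_flagRel (h : φ.Corresponds A A') {x x' : G.Flag} {y y' : H.Flag}
    (hxy : φ.FlagRel x y) (hxy' : φ.FlagRel x' y') (hx : G.subRel A x x') :
    H.subRel A' y y' := by
  rcases hxy with ⟨hxe, rfl⟩ | ⟨hxi, hyi, hxy⟩ <;>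
    rcases hxy' with ⟨hxe', rfl⟩ | ⟨hxi', hyi', hxy'⟩
  · exact h.subRel_flag (x := ⟨x, hxe⟩) (y := ⟨x', hxe'⟩) hx
  · exact absurd hxe (hxi' x ((hxi'.subRel_iff A x).1 ((G.subRel A).symm' hx)))
  · exact absurd hxe' (hxi x' ((hxi.subRel_iff A x').1 hx))
  · have h1 : Quotient.mk G.vertexRel x = Quotient.mk _ x' :=
      Quotient.sound ((hxi.subRel_iff A x').1 hx)
    rw [h1, hxy'] at hxy
    exact (hyi.subRel_iff A' y').2 (Quotient.exact hxy.symm)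

theorem Corresponds.subBoundary_eq (h : φ.Corresponds A A') :
    G.subBoundary A = H.subBoundary A' := by
  refine numClasses_eq_of_correspondence φ.FlagRel (φ.exists_flagRel A) (fun y => ?_)
    fun x x' y y' hxy hxy' => ⟨h.subRel_of_flagRel hxy hxy',
      h.symm.subRel_of_flagRel hxy.symm hxy'.symm⟩
  obtain ⟨y', x, hy, hx⟩ := φ.symm.exists_flagRel A' y
  exact ⟨y', x, hy, hx.symm⟩

theorem Corresponds.jump_eq (h : φ.Corresponds A A') (h' : φ.Corresponds B B') :
    G.jump A B = H.jump A' B' := by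
  rw [jump, jump, h.card_eq, h'.card_eq, h.vertCount_eq, h'.vertCount_eq, h.subBoundary_eq,
    h'.subBoundary_eq, h.dualCount_eq, h'.dualCount_eq]

theorem Corresponds.stateTerm_eq (h : φ.Corresponds A A') : G.stateTerm A = H.stateTerm A' := by
  rw [stateTerm, stateTerm, stateBase, stateBase, φ.corresponds_empty.jump_eq h,
    h.jump_eq φ.corresponds_edges, h.vertCount_eq, h.dualCount_eq, h.subBoundary_eq]

open Classical in
/-- The set of edges that corresponds to a given one. -/
noncomputable def mapEdges (φ : Equivalence G H) (A : Finset (Finset G.Flag)) :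
    Finset (Finset H.Flag) :=
  H.edges.filter fun e' => ∃ x : {x : G.Flag // G.OnEdge x},
    G.edgeOf x.1 ∈ A ∧ H.edgeOf (φ.flag x).1 = e'

theorem corresponds_mapEdges (φ : Equivalence G H) (hA : A ⊆ G.edges) :
    φ.Corresponds A (φ.mapEdges A) := by
  refine ⟨hA, Finset.filter_subset _ _, fun x => ?_⟩
  rw [mapEdges, Finset.mem_filter]
  constructor
  · exact fun h => ⟨H.edgeOf_mem_edges.2 (φ.flag x).2, x, h, rfl⟩
  · rintro ⟨-, y, hy, hyx⟩
    rwa [← φ.edgeOf_flag_eq_iff.1 hyx]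

theorem stateSum_eq (φ : Equivalence G H) : G.stateSum = H.stateSum := by
  have h1 : ∀ A ∈ G.edges.powerset, φ.Corresponds A (φ.mapEdges A) := fun A hA =>
    φ.corresponds_mapEdges (Finset.mem_powerset.1 hA)
  have h2 : ∀ A ∈ H.edges.powerset, φ.symm.Corresponds A (φ.symm.mapEdges A) := fun A hA =>
    φ.symm.corresponds_mapEdges (Finset.mem_powerset.1 hA)
  refine Finset.sum_nbij' φ.mapEdges φ.symm.mapEdges
    (fun A hA => Finset.mem_powerset.2 (h1 A hA).subset_right)
    (fun A hA => Finset.mem_powerset.2 (h2 A hA).subset_right)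
    (fun A hA => ?_) (fun A hA => ?_) fun A hA => (h1 A hA).stateTerm_eq
  · exact (φ.symm.corresponds_mapEdges (h1 A hA).subset_right).right_unique (h1 A hA).symm
  · exact (φ.corresponds_mapEdges (h2 A hA).subset_right).right_unique (h2 A hA).symm

end Equivalence

end ColouredRibbonGraph

end RibbonTutte

-- The map `U` is defined on presentations by flags; its invariance under `Equivalent` makes it a
-- map on coloured ribbon graphs up to homeomorphism. All claims reduce to `stateSum`.
open RibbonTutte in
theorem theorem3p8 (C : Set ColouredRibbonGraph) (hC : MinorClosed C) :
    (∃! U : C → CoeffRing, SatisfiesRecursion hC U) ∧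
    ∀ U : C → CoeffRing, SatisfiesRecursion hC U →
      (∀ G H : C, ColouredRibbonGraph.Equivalent G.1 H.1 → U G = U H) ∧
      ∀ (G : C) (K : Type*) [Field K] [Algebra CoeffRing K],
        Function.Injective (algebraMap CoeffRing K) →
        ∀ g : K, g ^ 2 = algebraMap CoeffRing K (MvPolynomial.X Var.gamma) →
          algebraMap CoeffRing K (U G) = G.1.universalValue K g := by
  refine ⟨⟨_, stateSum_satisfiesRecursion hC, fun U hU => funext hU.eq_stateSum⟩,
    fun U hU => ⟨fun G H h => ?_, fun G K _ _ hK g hg => ?_⟩⟩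
  · obtain ⟨φ⟩ := h
    rw [hU.eq_stateSum, hU.eq_stateSum, φ.stateSum_eq]
  · rw [hU.eq_stateSum, G.1.map_stateSum K hK g hg]
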